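/- Let $h$ be a real function defined on a neighbourhood of infinity, and suppose that either $h$ is regularly varying at infinity with negative index, or $h$ is slowly varying at infinity and (weakly) decreasing on a neighbourhood of infinity. (Regularly varying at infinity with index $p\in\mathbb R$ means: eventually positive and measurable, with $h(cx)/h(x)\to c^{p}$ as $x\to\infty$ for every $c>0$; slowly varying is $p=0$. Regular variation at zero is defined in the same way with $x\downarrow 0$.) Let $1<\beta<2$. Then there is a mean zero Gaussian process $G=\{G(x),x\ge 0\}$, $G(0)=0$, with stationary increments and increments variance $\sigma^2$, i.e. $E(G(x)-G(y))^2=\sigma^2(x-y)=\sigma^2(|x-y|)$, such that 1. $\sigma^2$ is regularly varying at zero with some index in $[1,2]$; 2. $\lim_{u\to0}u^2/\sigma^2(u)=0$ and $\lim_{u\to0}\sigma^2(u)/u=0$; 3. for some constant $C$, $\dfrac{|\sigma^2(s+u)+\sigma^2(s-u)-2\sigma^2(s)|}{u^2}\le C\,\dfrac{\sigma^2(s)}{s^2}$ whenever $0<u\le s/8$; 4. $\sigma^2$ has a second derivative at each $s\neq0$; write $\rho(s)=\frac12\frac{d^2}{ds^2}\sigma^2(s)$, $s\ne 0$; 5.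 there is $\zeta>0$ such that for every $0<M<\infty$ there is $C_M<\infty$ with $$|\rho(x)|\le \frac{C_M}{|x|^{\zeta}}\quad(0<|x|\le M),\qquad |\rho(x+u)-\rho(x)|\le C_M\frac{|u|}{|x|}\,|\rho(x)|\quad(4|u|\le|x|\le M,\ x\neq 0);$$ 6. $\sigma^2(x)\sim|x|^{\beta}\,h(\log 1/|x|)$ as $x\to0$. Moreover, $\sigma^2$ can be taken to be an FB-mixture, that is, $\sigma^2(x)=\int_\beta^2|x|^{s}\,d\mu(s)$ for all $x\in\mathbb R$, where $\mu$ is a finite positive measure on $[\beta,2]$ with $\int_\beta^2\frac{d\mu(s)}{2-s}<\infty$. -/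

import Mathlib

open MeasureTheory ProbabilityTheory Filter Asymptotics Set
open scoped Topology NNReal ENNReal

namespace GaussInc

/-- `f` is regularly varying at infinity with index `p`: on some half line it is defined, positive
and (Lebesgue) measurable, and `f (c x) / f x → c ^ p` as `x → ∞` for every `c > 0`.
Slow variation is the case `p = 0`. -/
structure RegVaryingAtTop (f : ℝ → ℝ) (p : ℝ) : Prop where
  pos_meas : ∃ A : ℝ, (∀ x ∈ Ici A, 0 < f x) ∧ AEMeasurable f (volume.restrict (Ici A))
  tendsto : ∀ c : ℝ, 0 < c → Tendsto (fun x => f (c * x) / f x) atTop (𝓝 (c ^ p))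

/-- `f` is regularly varying at zero (from the right) with index `p`. -/
structure RegVaryingAtZero (f : ℝ → ℝ) (p : ℝ) : Prop where
  pos_meas : ∃ δ : ℝ, 0 < δ ∧ (∀ x ∈ Ioo 0 δ, 0 < f x) ∧
    AEMeasurable f (volume.restrict (Ioo 0 δ))
  tendsto : ∀ c : ℝ, 0 < c → Tendsto (fun x => f (c * x) / f x) (𝓝[>] 0) (𝓝 (c ^ p))

/-- The process `G` has stationary increments: for every `t`, the processes
`x ↦ G (t + x) - G t` and `x ↦ G x - G 0` have the same finite dimensional distributions. -/
def HasStationaryIncrements {Ω : Type*} [MeasurableSpace Ω] (G : ℝ≥0 → Ω → ℝ)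
    (P : Measure Ω) : Prop :=
  ∀ (t : ℝ≥0) (I : Finset ℝ≥0),
    IdentDistrib (fun ω (x : I) => G (t + (x : ℝ≥0)) ω - G t ω)
      (fun ω (x : I) => G (x : ℝ≥0) ω - G 0 ω) P P

/-- `G = {G x, x ≥ 0}` is a mean zero Gaussian process with stationary increments and `G 0 = 0`,
and `v` is its increments variance, `E (G x - G y)² = v (x - y)`. Since `x` and `y` may be
exchanged, this determines the function `v` on the whole line and makes it even. -/
structure IsStationaryIncrementGaussian {Ω : Type*} [MeasurableSpace Ω] (P : Measure Ω)
    (G : ℝ≥0 → Ω → ℝ) (v : ℝ → ℝ) : Prop where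
  gaussian : IsGaussianProcess G P
  zero : ∀ ω, G 0 ω = 0
  mean_zero : ∀ x, ∫ ω, G x ω ∂P = 0
  stationary : HasStationaryIncrements G P
  variance_eq : ∀ x y : ℝ≥0, ∫ ω, (G x ω - G y ω) ^ 2 ∂P = v ((x : ℝ) - (y : ℝ))

/-- Half the second derivative of the increments variance, used away from `0`. -/
noncomputable def rho (v : ℝ → ℝ) (s : ℝ) : ℝ := (1 / 2) * deriv (deriv v) s

/-- The regularity conditions imposed on the increments variance `v = σ²`. -/
structure IncrementConditions (v : ℝ → ℝ) : Prop where
  /-- `v` is regularly varying at zero with some index in `[1, 2]`. -/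
  regVarying : ∃ b : ℝ, 1 ≤ b ∧ b ≤ 2 ∧ RegVaryingAtZero v b
  sq_div_tendsto : Tendsto (fun h => h ^ 2 / v h) (𝓝[≠] 0) (𝓝 0)
  div_tendsto : Tendsto (fun h => v h / h) (𝓝[≠] 0) (𝓝 0)
  second_difference : ∃ C : ℝ, ∀ s h : ℝ, 0 < h → h ≤ s / 8 →
    |v (s + h) + v (s - h) - 2 * v s| / h ^ 2 ≤ C * (v s / s ^ 2)
  /-- `v` has a second derivative at each `s ≠ 0`. -/
  twice_diff : ∀ s : ℝ, s ≠ 0 → DifferentiableAt ℝ v s ∧ DifferentiableAt ℝ (deriv v) s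
  rho_bounds : ∃ ζ : ℝ, 0 < ζ ∧ ∀ M : ℝ, 0 < M → ∃ C : ℝ,
    (∀ x : ℝ, x ≠ 0 → |x| ≤ M → |rho v x| ≤ C / |x| ^ ζ) ∧
    (∀ x h : ℝ, x ≠ 0 → 4 * |h| ≤ |x| → |x| ≤ M →
      |rho v (x + h) - rho v x| ≤ C * (|h| / |x|) * |rho v x|)

/-- `v` is an FB-mixture with parameter `β`: `v x = ∫ |x| ^ s dμ(s)` for a finite positive
measure `μ` carried by `[β, 2]` with `∫ dμ(s) / (2 - s) < ∞`; the last integrand is `∞` at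
`s = 2`. -/
def IsFBMixture (β : ℝ) (v : ℝ → ℝ) : Prop :=
  ∃ μ : Measure ℝ, IsFiniteMeasure μ ∧ μ (Icc β 2)ᶜ = 0 ∧
    ∫⁻ s, (ENNReal.ofReal (2 - s))⁻¹ ∂μ < ∞ ∧
    ∀ x : ℝ, v x = ∫ s, |x| ^ s ∂μ

end GaussInc

/-! Since |x|^(β+t) = |x|^β exp(-t log(1/|x|)), the FB-mixture of the shift by β of a measure m on
[0, δ] is |x|^β times the Laplace transform of m at log(1/|x|). So it suffices to find a finite m
whose Laplace transform is asymptotic to h at infinity.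

This is an Abelian argument. First h is replaced by an equivalent nonincreasing k: h itself in the
slowly varying case, its running supremum when the index is negative, where the uniform convergence
theorem makes h almost decreasing. Then t ↦ k(1/t), cut off, is monotone and so generates a
Stieltjes measure, whose Laplace transform is asymptotic to Γ(1-p) k. Dividing by Γ(1-p) gives m
(`AntitoneRegVarying.exists_laplace`).

Taking δ = (2-β)/2 puts the exponents in [β, b] with b < 2. The regularity conditions are then
inequalities for single powers, uniform in the exponent, integrated against μ
(`incrementConditions_mixture`).

For the process, |x|^s is a constant multiple of ∫ |exp(ilx)-1|² l^(-1-s) dl over l > 0, so the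
mixture has a spectral measure ν. The curve x ↦ exp(ilx)-1 in L²(ν) has increments stationary up to
isometry, and an isonormal Gaussian family carries it to the required process
(`exists_gaussian_of_spectral`). -/

namespace GaussInc

/-! ### Uniform convergence for slowly varying functions. -/

/-- On a finite measure space pointwise convergence implies convergence in measure. The interval [0,
3] contains [1, 3] - t for every t in [0, 1], which the covering argument below needs. -/
lemma tendsto_measure_shift_sub {g : ℝ → ℝ} {a : ℝ}
    (hg : AEMeasurable g (volume.restrict (Ici a)))
    (hlim : ∀ t, Tendsto (fun x => g (x + t) - g x) atTop (𝓝 0)) {x : ℕ → ℝ}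
    (hx : Tendsto x atTop atTop) (hxa : ∀ n, a ≤ x n) {ε : ℝ} (hε : 0 < ε) :
    Tendsto (fun n => (volume.restrict (Icc 0 3)) {y | ε ≤ |g (x n + y) - g (x n)|})
      atTop (𝓝 0) := by
  have hT : TendstoInMeasure (volume.restrict (Icc (0 : ℝ) 3))
      (fun n y => g (x n + y) - g (x n)) atTop (fun _ => (0 : ℝ)) := by
    refine tendstoInMeasure_of_tendsto_ae (fun n => ?_)
      (Eventually.of_forall fun y => (hlim y).comp hx)
    refine AEMeasurable.aestronglyMeasurable (AEMeasurable.sub_const ?_ _)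
    have h1 : MeasurePreserving (fun y : ℝ => x n + y)
        (volume.restrict ((fun y : ℝ => x n + y) ⁻¹' Ici a)) (volume.restrict (Ici a)) :=
      (measurePreserving_add_left volume (x n)).restrict_preimage measurableSet_Ici
    refine (hg.comp_quasiMeasurePreserving h1.quasiMeasurePreserving).mono_measure
      (Measure.restrict_mono (fun y hy => ?_) le_rfl)
    simp only [mem_preimage, mem_Ici]
    linarith [hxa n, hy.1]
  have := tendstoInMeasure_iff_norm.1 hT ε hε
  simpa [Real.norm_eq_abs] using this

/-- The uniform convergence theorem for slowly varying functions, in additive form. -/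
lemma eventually_abs_shift_sub_le {g : ℝ → ℝ} {a : ℝ}
    (hg : AEMeasurable g (volume.restrict (Ici a)))
    (hlim : ∀ t, Tendsto (fun x => g (x + t) - g x) atTop (𝓝 0)) {ε : ℝ} (hε : 0 < ε) :
    ∃ X, ∀ x ≥ X, ∀ t ∈ Icc (0 : ℝ) 1, |g (x + t) - g x| ≤ ε := by
  by_contra! hcon
  choose x hx t ht hxt using fun n : ℕ => hcon (max a n)
  have hx1 : Tendsto x atTop atTop :=
    tendsto_atTop_mono (fun n => (le_max_right _ _).trans (hx n)) tendsto_natCast_atTop_atTop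
  have hx2 : Tendsto (fun n => x n + t n) atTop atTop :=
    tendsto_atTop_mono (fun n => by linarith [(ht n).1]) hx1
  have e2 : 0 < ε / 2 := by positivity
  have h1 := tendsto_measure_shift_sub hg hlim hx1
    (fun n => (le_max_left _ _).trans (hx n)) e2
  have h2 := tendsto_measure_shift_sub hg hlim hx2
    (fun n => by linarith [(le_max_left a (n : ℝ)).trans (hx n), (ht n).1]) e2
  obtain ⟨n, hn1, hn2⟩ := ((h1.eventually_lt_const one_pos).and
    (h2.eventually_lt_const one_pos)).exists
  rw [Measure.restrict_apply' measurableSet_Icc] at hn1 hn2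
  set B₁ := {y | ε / 2 ≤ |g (x n + y) - g (x n)|} ∩ Icc 0 3
  set B₂ := {y | ε / 2 ≤ |g (x n + t n + y) - g (x n + t n)|} ∩ Icc 0 3
  -- A point outside both sets is within ε/2 in value of both endpoints `x n` and `x n + t n`,
  -- against `hxt`. Hence two sets of measure less than 1 would cover an interval of length 2.
  have hsub : Icc (1 : ℝ) 3 ⊆ B₁ ∪ (fun y => y + -t n) ⁻¹' B₂ := by
    intro y hy
    by_contra hy'
    rw [mem_union, not_or] at hy'
    obtain ⟨hy1, hy2⟩ := hy'
    have c1 : |g (x n + y) - g (x n)| < ε / 2 := by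
      by_contra! hc
      exact hy1 ⟨hc, by linarith [hy.1], hy.2⟩
    have c2 : |g (x n + t n + (y - t n)) - g (x n + t n)| < ε / 2 := by
      by_contra! hc
      rw [mem_preimage, ← sub_eq_add_neg] at hy2
      exact hy2 ⟨hc, by linarith [hy.1, (ht n).2], by linarith [hy.2, (ht n).1]⟩
    rw [show x n + t n + (y - t n) = x n + y by ring] at c2
    have c3 := hxt n
    rw [abs_lt] at c1 c2
    have : |g (x n + t n) - g (x n)| < ε := abs_lt.2 ⟨by linarith, by linarith⟩
    linarith
  have := (measure_mono hsub).trans (measure_union_le (μ := volume) _ _)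
  rw [measure_preimage_add_right, Real.volume_Icc] at this
  have h3 := this.trans_lt (ENNReal.add_lt_add hn1 hn2)
  norm_num at h3

/-- A shift by t decomposes into ⌊t⌋ unit steps and one shorter step, each costing at most ε. -/
lemma abs_sub_le_of_abs_shift_sub_le {g : ℝ → ℝ} {X ε : ℝ}
    (hX : ∀ x ≥ X, ∀ t ∈ Icc (0 : ℝ) 1, |g (x + t) - g x| ≤ ε) {x t : ℝ} (hx : X ≤ x)
    (ht : 0 ≤ t) : |g (x + t) - g x| ≤ ε * (t + 1) := by
  have key : ∀ n : ℕ, ∀ t : ℝ, 0 ≤ t → t ≤ n + 1 → |g (x + t) - g x| ≤ ε * (n + 1) := by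
    intro n
    induction n with
    | zero => intro t h0 h1; simpa using hX x hx t ⟨h0, by simpa using h1⟩
    | succ n ih =>
      intro t h0 h1
      have hε : 0 ≤ ε := (abs_nonneg _).trans (hX x hx 0 ⟨le_rfl, zero_le_one⟩)
      push_cast at h1 ⊢
      rcases le_total t 1 with h | h
      · have := hX x hx t ⟨h0, h⟩
        have h3 : 0 ≤ ε * ((n : ℝ) + 1) := by positivity
        linarith
      · have e1 := ih (t - 1) (by linarith) (by linarith)
        have e2 := hX (x + (t - 1)) (by linarith) 1 ⟨zero_le_one, le_rfl⟩
        rw [show x + (t - 1) + 1 = x + t by ring] at e2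
        have := abs_sub_le (g (x + t)) (g (x + (t - 1))) (g x)
        linarith
  have hε : 0 ≤ ε := (abs_nonneg _).trans (hX x hx 0 ⟨le_rfl, zero_le_one⟩)
  refine (key ⌊t⌋₊ t ht (Nat.lt_floor_add_one t).le).trans ?_
  gcongr
  exact Nat.floor_le ht

/-- The preimage of a null set is the image under the logarithm of its positive part, and
differentiable maps send null sets to null sets. This is needed because h is only a.e. measurable
and gets composed with the exponential. -/
lemma quasiMeasurePreserving_exp :
    Measure.QuasiMeasurePreserving Real.exp volume volume := by
  refine ⟨Real.measurable_exp, Measure.AbsolutelyContinuous.mk fun s hs h0 => ?_⟩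
  rw [Measure.map_apply Real.measurable_exp hs]
  have : Real.exp ⁻¹' s = Real.log '' (s ∩ Ioi 0) := by
    ext x
    constructor
    · intro hx
      exact ⟨Real.exp x, ⟨hx, Real.exp_pos x⟩, Real.log_exp x⟩
    · rintro ⟨y, ⟨hy, hy0⟩, rfl⟩
      rwa [mem_preimage, Real.exp_log hy0]
  rw [this]
  refine addHaar_image_eq_zero_of_differentiableOn_of_addHaar_eq_zero volume ?_
    (measure_mono_null inter_subset_left h0)
  intro y hy
  exact (Real.differentiableAt_log (ne_of_gt hy.2)).differentiableWithinAt

/-- A regularly varying function of negative index is almost decreasing. -/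
lemma RegVaryingAtTop.eventually_le {h : ℝ → ℝ} {p : ℝ} (hp : p < 0) (hh : RegVaryingAtTop h p)
    {ε : ℝ} (hε : 0 < ε) :
    ∃ X, 0 < X ∧ ∀ x ≥ X, 0 < h x ∧ ∀ y ≥ x, h y ≤ (1 + ε) * h x := by
  obtain ⟨A, hpos, hmeas⟩ := hh.pos_meas
  set B := max A 1
  have hB : 0 < B := lt_of_lt_of_le one_pos (le_max_right _ _)
  have hposB : ∀ x ≥ B, 0 < h x := fun x hx => hpos x ((le_max_left _ _).trans hx)
  -- In logarithmic coordinates, with the drift p x removed, regular variation says that the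
  -- increments of g tend to 0.
  set g : ℝ → ℝ := fun x => Real.log (h (Real.exp x)) - p * x
  have hexpB : ∀ x ≥ Real.log B, B ≤ Real.exp x := fun x hx => (Real.log_le_iff_le_exp hB).1 hx
  have hg : AEMeasurable g (volume.restrict (Ici (Real.log B))) := by
    refine AEMeasurable.sub (Real.measurable_log.comp_aemeasurable ?_) (by fun_prop)
    have hq : Measure.QuasiMeasurePreserving Real.exp (volume.restrict (Ici (Real.log B)))
        (volume.restrict (Ici A)) :=
      quasiMeasurePreserving_exp.restrict fun x hx =>
        (le_max_left _ _).trans (hexpB x hx)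
    exact hmeas.comp_quasiMeasurePreserving hq
  have hlim : ∀ t, Tendsto (fun x => g (x + t) - g x) atTop (𝓝 0) := by
    intro t
    have h1 := (hh.tendsto (Real.exp t) (Real.exp_pos t)).comp Real.tendsto_exp_atTop
    rw [← Real.exp_mul] at h1
    have h2 := ((Real.continuousAt_log (Real.exp_pos _).ne').tendsto.comp h1).sub_const (p * t)
    rw [Real.log_exp, mul_comm, sub_self] at h2
    refine h2.congr' ?_
    filter_upwards [eventually_ge_atTop (Real.log B), eventually_ge_atTop (Real.log B - t)]
      with x hx hx'
    have e1 : h (Real.exp x) ≠ 0 := (hposB _ (hexpB x hx)).ne'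
    have e2 : h (Real.exp (x + t)) ≠ 0 := (hposB _ (hexpB _ (by linarith))).ne'
    simp only [Function.comp_apply, g]
    rw [mul_comm (Real.exp t), ← Real.exp_add, Real.log_div e2 e1]
    ring
  -- With τ = log y - log x, the bound is log h(y) - log h(x) ≤ pτ + δ(τ + 1): δ ≤ -p lets the drift
  -- absorb δτ, and the remaining δ is at most log(1 + ε).
  set δ := min (Real.log (1 + ε)) (-p)
  have hδ : 0 < δ := lt_min (Real.log_pos (by linarith)) (by linarith)
  obtain ⟨X, hX⟩ := eventually_abs_shift_sub_le hg hlim hδ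
  refine ⟨max B (Real.exp X), lt_max_of_lt_left hB, fun x hx => ?_⟩
  have hxB : B ≤ x := (le_max_left _ _).trans hx
  have hx0 : 0 < x := hB.trans_le hxB
  refine ⟨hposB x hxB, fun y hy => ?_⟩
  have hy0 : 0 < y := hx0.trans_le hy
  have hXx : X ≤ Real.log x := (Real.le_log_iff_exp_le hx0).2 ((le_max_right _ _).trans hx)
  have ht : 0 ≤ Real.log y - Real.log x := sub_nonneg.2 (Real.log_le_log hx0 hy)
  have h1 := (abs_le.1 (abs_sub_le_of_abs_shift_sub_le hX hXx ht)).2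
  simp only [g, add_sub_cancel, Real.exp_log hx0, Real.exp_log hy0] at h1
  have h2 : δ * (Real.log y - Real.log x) ≤ -p * (Real.log y - Real.log x) :=
    mul_le_mul_of_nonneg_right (min_le_right _ _) ht
  have h3 : δ ≤ Real.log (1 + ε) := min_le_left _ _
  have hxp := hposB x hxB
  have hyp := hposB y (hxB.trans hy)
  rw [← Real.log_le_log_iff hyp (by positivity), Real.log_mul (by positivity) hxp.ne']
  nlinarith

/-! ### Reduction to nonincreasing functions. -/

/-- The functions to which the construction of the mixing measure applies: positive and
nonincreasing near infinity and regularly varying with index `p`. -/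
structure AntitoneRegVarying (k : ℝ → ℝ) (p A : ℝ) : Prop where
  index_nonpos : p ≤ 0
  pos_left : 0 < A
  pos : ∀ x ≥ A, 0 < k x
  anti : AntitoneOn k (Ici A)
  tendsto : ∀ c : ℝ, 0 < c → Tendsto (fun x => k (c * x) / k x) atTop (𝓝 (c ^ p))

lemma tendsto_ratio_of_isEquivalent {h k : ℝ → ℝ} {p : ℝ} (hk : k ~[atTop] h)
    (hh : ∀ c : ℝ, 0 < c → Tendsto (fun x => h (c * x) / h x) atTop (𝓝 (c ^ p))) (c : ℝ)
    (hc : 0 < c) : Tendsto (fun x => k (c * x) / k x) atTop (𝓝 (c ^ p)) := by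
  have h1 : (fun x => k (c * x)) ~[atTop] fun x => h (c * x) :=
    hk.comp_tendsto (tendsto_id.const_mul_atTop hc)
  exact (h1.div hk).symm.tendsto_nhds (hh c hc)

/-- For negative index the running supremum over [x, ∞) is nonincreasing, and almost monotonicity
squeezes it between h and (1 + ε) h for large x. -/
lemma exists_antitone_isEquivalent {h : ℝ → ℝ}
    (hh : (∃ p : ℝ, p < 0 ∧ RegVaryingAtTop h p) ∨
      (RegVaryingAtTop h 0 ∧ ∃ A : ℝ, AntitoneOn h (Ici A))) :
    ∃ k p A, AntitoneRegVarying k p A ∧ k ~[atTop] h := by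
  rcases hh with ⟨p, hp, hh⟩ | ⟨hh, A, hA⟩
  · obtain ⟨A, hA0, hA⟩ := hh.eventually_le hp one_pos
    set k : ℝ → ℝ := fun x => sSup (h '' Ici x)
    have hbdd : ∀ x ≥ A, BddAbove (h '' Ici x) := by
      rintro x hx
      refine ⟨(1 + 1) * h x, ?_⟩
      rintro _ ⟨y, hy, rfl⟩
      exact (hA x hx).2 y hy
    have hle : ∀ x ≥ A, h x ≤ k x := fun x hx =>
      le_csSup (hbdd x hx) (mem_image_of_mem h self_mem_Ici)
    have hequiv : k ~[atTop] h := by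
      rw [isEquivalent_iff_tendsto_one]
      · rw [Metric.tendsto_atTop]
        intro ε hε
        obtain ⟨X, hX0, hX⟩ := hh.eventually_le hp (half_pos hε)
        refine ⟨max A X, fun x hx => ?_⟩
        have hxA : A ≤ x := (le_max_left _ _).trans hx
        have hxX : X ≤ x := (le_max_right _ _).trans hx
        obtain ⟨hx0, hx1⟩ := hX x hxX
        have h2 : k x ≤ (1 + ε / 2) * h x := by
          refine csSup_le ⟨h x, mem_image_of_mem h self_mem_Ici⟩ ?_
          rintro _ ⟨y, hy, rfl⟩
          exact hx1 y hy
        have h1 := hle x hxA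
        rw [Real.dist_eq, Pi.div_apply, abs_of_nonneg (by rw [sub_nonneg, one_le_div hx0]; exact h1)]
        have := (div_le_iff₀ hx0).2 h2
        linarith
      · filter_upwards [eventually_ge_atTop A] with x hx using (hA x hx).1.ne'
    refine ⟨k, p, A, ⟨hp.le, hA0, fun x hx => (hA x hx).1.trans_le (hle x hx), ?_,
      tendsto_ratio_of_isEquivalent hequiv hh.tendsto⟩, hequiv⟩
    intro x hx y hy hxy
    exact csSup_le_csSup (hbdd x hx) ⟨h y, mem_image_of_mem h self_mem_Ici⟩
      (image_mono (Ici_subset_Ici.2 hxy))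
  · obtain ⟨B, hB, -⟩ := hh.pos_meas
    exact ⟨h, 0, max (max A B) 1, ⟨le_rfl, by positivity,
      fun x hx => hB x ((le_max_right _ _).trans ((le_max_left _ _).trans hx)),
      hA.mono (Ici_subset_Ici.2 ((le_max_left _ _).trans (le_max_left _ _))), hh.tendsto⟩,
      IsEquivalent.refl⟩

/-- Translation does not affect a monotone regularly varying function asymptotically. -/
lemma AntitoneRegVarying.tendsto_add {k : ℝ → ℝ} {p A : ℝ} (hk : AntitoneRegVarying k p A)
    (a : ℝ) : Tendsto (fun x => k (x + a) / k x) atTop (𝓝 1) := by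
  have hnn : ∀ a : ℝ, 0 ≤ a → Tendsto (fun x => k (x + a) / k x) atTop (𝓝 1) := by
    intro a ha
    rw [tendsto_order]
    refine ⟨fun b hb => ?_, fun b hb => ?_⟩
    · have h1 : Tendsto (fun c : ℝ => c ^ p) (𝓝[>] 1) (𝓝 1) := by
        have : ContinuousAt (fun c : ℝ => c ^ p) 1 :=
          Real.continuousAt_rpow_const _ _ (Or.inl one_ne_zero)
        simpa [ContinuousAt] using this.tendsto.mono_left nhdsWithin_le_nhds
      -- For c > 1 near 1, x + a ≤ c x eventually, so the ratio is at least k(c x) / k(x), whose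
      -- limit c^p exceeds b.
      obtain ⟨c, hc, hc1⟩ := ((h1.eventually_const_lt hb).and self_mem_nhdsWithin).exists
      have hc1 : 1 < c := hc1
      filter_upwards [(hk.tendsto c (by linarith)).eventually_const_lt hc,
        eventually_ge_atTop (a / (c - 1)), eventually_ge_atTop A] with x hx hxa hxA
      refine hx.trans_le (div_le_div_of_nonneg_right ?_ (hk.pos x hxA).le)
      rw [div_le_iff₀ (by linarith)] at hxa
      have h2 : x + a ≤ c * x := by linarith
      exact hk.anti (by simp only [mem_Ici]; linarith) (by simp only [mem_Ici]; linarith) h2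
    · filter_upwards [eventually_ge_atTop A] with x hxA
      refine lt_of_le_of_lt ((div_le_one (hk.pos x hxA)).2 ?_) hb
      exact hk.anti hxA (by simp only [mem_Ici]; linarith) (by linarith)
  rcases le_total 0 a with ha | ha
  · exact hnn a ha
  · have h1 := ((hnn (-a) (by linarith)).comp (tendsto_atTop_add_const_right atTop a tendsto_id)).inv₀
      one_ne_zero
    rw [inv_one] at h1
    refine h1.congr fun x => ?_
    simp

/-! ### The Abelian theorem. -/

/-- The function `t ↦ k (1 / t)`, cut off at `t = 1 / B` and extended by zero to `t ≤ 0`. -/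
noncomputable def recipCutoff (k : ℝ → ℝ) (B t : ℝ) : ℝ :=
  if t ≤ 0 then 0 else k (max t⁻¹ B)

section recipCutoff

variable {k : ℝ → ℝ} {p A B : ℝ}

lemma recipCutoff_of_nonpos {t : ℝ} (ht : t ≤ 0) : recipCutoff k B t = 0 := if_pos ht

lemma recipCutoff_of_pos {t : ℝ} (ht : 0 < t) : recipCutoff k B t = k (max t⁻¹ B) :=
  if_neg ht.not_ge

lemma recipCutoff_nonneg (hk : AntitoneRegVarying k p A) (hB : A ≤ B) (t : ℝ) :
    0 ≤ recipCutoff k B t := by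
  unfold recipCutoff
  split_ifs
  · exact le_rfl
  · exact (hk.pos _ (hB.trans (le_max_right _ _))).le

lemma recipCutoff_le (hk : AntitoneRegVarying k p A) (hB : A ≤ B) (t : ℝ) :
    recipCutoff k B t ≤ k B := by
  unfold recipCutoff
  split_ifs
  · exact (hk.pos _ hB).le
  · exact hk.anti hB (hB.trans (le_max_right _ _)) (le_max_right _ _)

lemma monotone_recipCutoff (hk : AntitoneRegVarying k p A) (hB : A ≤ B) :
    Monotone (recipCutoff k B) := by
  intro s t hst
  rcases le_or_gt s 0 with hs | hs
  · rw [recipCutoff_of_nonpos hs]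
    exact recipCutoff_nonneg hk hB t
  · rw [recipCutoff_of_pos hs, recipCutoff_of_pos (hs.trans_le hst)]
    exact hk.anti (hB.trans (le_max_right _ _)) (hB.trans (le_max_right _ _))
      (max_le_max_right _ (inv_anti₀ hs hst))

lemma recipCutoff_of_inv_le (hB0 : 0 < B) {t : ℝ} (ht : B⁻¹ ≤ t) : recipCutoff k B t = k B := by
  rw [recipCutoff_of_pos ((inv_pos.2 hB0).trans_le ht), max_eq_right (inv_le_of_inv_le₀ hB0 ht)]

/-- For small t this is regular variation with ratio 1/2; for the other t both sides lie between
positive constants. Writing the constant as 2^K makes its iterates polynomial. -/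
lemma exists_recipCutoff_two_mul_le (hk : AntitoneRegVarying k p A) (hB : A ≤ B) :
    ∃ K : ℕ, ∀ t, 0 < t → recipCutoff k B (2 * t) ≤ 2 ^ K * recipCutoff k B t := by
  have h1 := (hk.tendsto (1 / 2) (by norm_num)).eventually_le_const (lt_add_one _)
  obtain ⟨X, hX⟩ := eventually_atTop.1 h1
  set D := (1 / 2 : ℝ) ^ p + 1
  -- The factor 2 keeps both 1/t and 1/(2t) beyond the cutoff B when 1/t ≥ Y.
  set Y := max X (2 * B)
  have hB0 : 0 < B := hk.pos_left.trans_le hB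
  have hBY : B ≤ Y := by linarith [le_max_right X (2 * B)]
  have hkY : 0 < k Y := hk.pos _ (hB.trans hBY)
  obtain ⟨K, hK⟩ := pow_unbounded_of_one_lt (max D (k B / k Y)) (one_lt_two (α := ℝ))
  refine ⟨K, fun t ht => ?_⟩
  have h0 := recipCutoff_nonneg hk hB t
  rcases le_or_gt Y t⁻¹ with hY | hY
  · have hXt : X ≤ t⁻¹ := (le_max_left _ _).trans hY
    have hBt : 2 * B ≤ t⁻¹ := (le_max_right _ _).trans hY
    have e1 : recipCutoff k B t = k t⁻¹ := by
      rw [recipCutoff_of_pos ht, max_eq_left (by linarith)]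
    have e2 : recipCutoff k B (2 * t) = k (1 / 2 * t⁻¹) := by
      rw [recipCutoff_of_pos (by linarith), mul_inv, max_eq_left (by linarith), one_div]
    have h2 := hX _ hXt
    rw [div_le_iff₀ (hk.pos _ (by linarith))] at h2
    rw [e1] at h0 ⊢
    rw [e2]
    exact h2.trans (mul_le_mul_of_nonneg_right ((le_max_left _ _).trans hK.le) h0)
  · have h2 : k Y ≤ recipCutoff k B t := by
      rw [recipCutoff_of_pos ht]
      exact hk.anti (hB.trans (le_max_right _ _)) (hB.trans hBY) (max_le hY.le hBY)
    calc recipCutoff k B (2 * t) ≤ k B := recipCutoff_le hk hB _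
      _ = k B / k Y * k Y := by field_simp
      _ ≤ 2 ^ K * recipCutoff k B t :=
        mul_le_mul ((le_max_right _ _).trans hK.le) h2 hkY.le (by positivity)

/-- A Potter-type bound, serving as the dominating function below. Monotonicity handles u ≤ 1; for u
≥ 1 the doubling bound is iterated up to the first power of 2 above u. -/
lemma recipCutoff_mul_le (hk : AntitoneRegVarying k p A) (hB : A ≤ B) {K : ℕ}
    (hK : ∀ t, 0 < t → recipCutoff k B (2 * t) ≤ 2 ^ K * recipCutoff k B t) {u t : ℝ}
    (hu : 0 < u) (ht : 0 < t) :
    recipCutoff k B (u * t) ≤ (1 + (2 * u) ^ K) * recipCutoff k B t := by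
  have hmono := monotone_recipCutoff hk hB
  have h0 := recipCutoff_nonneg hk hB t
  rcases le_total u 1 with h1 | h1
  · have h2 : recipCutoff k B (u * t) ≤ recipCutoff k B t := hmono (by nlinarith)
    have h3 : 0 ≤ (2 * u) ^ K * recipCutoff k B t := by positivity
    linarith
  · have hpow : ∀ n : ℕ, recipCutoff k B (2 ^ n * t) ≤ (2 ^ n) ^ K * recipCutoff k B t := by
      intro n
      induction n with
      | zero => simp
      | succ n ih =>
        calc recipCutoff k B (2 ^ (n + 1) * t) = recipCutoff k B (2 * (2 ^ n * t)) := by ring_nf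
          _ ≤ 2 ^ K * recipCutoff k B (2 ^ n * t) := hK _ (by positivity)
          _ ≤ 2 ^ K * ((2 ^ n) ^ K * recipCutoff k B t) := by gcongr
          _ = (2 ^ (n + 1)) ^ K * recipCutoff k B t := by rw [pow_succ' 2 n, mul_pow]; ring
    obtain ⟨n, hn1, hn2⟩ := exists_nat_pow_near h1 (one_lt_two (α := ℝ))
    calc recipCutoff k B (u * t) ≤ recipCutoff k B (2 ^ (n + 1) * t) := hmono (by gcongr)
      _ ≤ (2 ^ (n + 1)) ^ K * recipCutoff k B t := hpow _
      _ ≤ (2 * u) ^ K * recipCutoff k B t := by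
        rw [pow_succ' (2 : ℝ) n]
        gcongr
      _ ≤ (1 + (2 * u) ^ K) * recipCutoff k B t := by
        gcongr
        linarith

/-- After division by k(X) the integrand tends to exp(-u) u^(-p), dominated by exp(-u) (1 + (2u)^K).
-/
lemma tendsto_integral_exp_mul_recipCutoff (hk : AntitoneRegVarying k p A) (hB : A ≤ B) :
    Tendsto (fun X => (∫ u in Ioi 0, Real.exp (-u) * recipCutoff k B (u / X)) / k X) atTop
      (𝓝 (Real.Gamma (1 - p))) := by
  obtain ⟨K, hK⟩ := exists_recipCutoff_two_mul_le hk hB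
  have hB0 : 0 < B := hk.pos_left.trans_le hB
  have hmono := monotone_recipCutoff hk hB
  simp_rw [← integral_div]
  rw [Real.Gamma_eq_integral (by linarith [hk.index_nonpos])]
  refine tendsto_integral_filter_of_dominated_convergence
    (fun u => Real.exp (-u) * (1 + (2 * u) ^ K)) ?_ ?_ ?_ ?_
  · refine Eventually.of_forall fun X => Measurable.aestronglyMeasurable ?_
    have := hmono.measurable
    fun_prop
  · filter_upwards [eventually_ge_atTop B] with X hX
    have hX0 : 0 < X := hB0.trans_le hX
    refine (ae_restrict_iff' measurableSet_Ioi).2 (Eventually.of_forall fun u hu => ?_)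
    have hu : 0 < u := hu
    have hkX : 0 < k X := hk.pos _ (hB.trans hX)
    have h1 := recipCutoff_mul_le hk hB hK hu (inv_pos.2 hX0)
    rw [recipCutoff_of_pos (inv_pos.2 hX0), inv_inv, max_eq_left hX, ← div_eq_mul_inv] at h1
    have h0 := recipCutoff_nonneg hk hB (u / X)
    rw [Real.norm_of_nonneg (by positivity), div_le_iff₀ hkX, mul_assoc]
    gcongr
  · have h1 := Real.GammaIntegral_convergent (s := 1) one_pos
    have h2 := (Real.GammaIntegral_convergent (s := (K : ℝ) + 1) (by positivity)).const_mul (2 ^ K)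
    refine IntegrableOn.congr_fun (h1.add h2) (fun u hu => ?_) measurableSet_Ioi
    simp [mul_pow]
    ring
  · refine (ae_restrict_iff' measurableSet_Ioi).2 (Eventually.of_forall fun u hu => ?_)
    have hu : 0 < u := hu
    have h1 := (hk.tendsto u⁻¹ (inv_pos.2 hu)).const_mul (Real.exp (-u))
    rw [Real.inv_rpow hu.le, ← Real.rpow_neg hu.le] at h1
    rw [show 1 - p - 1 = -p by ring]
    refine h1.congr' ?_
    filter_upwards [eventually_ge_atTop (B * u), eventually_gt_atTop 0] with X hX hX0
    rw [recipCutoff_of_pos (by positivity), inv_div, max_eq_left ((le_div_iff₀ hu).2 hX),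
      mul_div_assoc, div_eq_inv_mul X u]

/-! ### Laplace transforms of Stieltjes measures. -/

/-- The Stieltjes measure of a monotone function that vanishes on the negative half line. -/
lemma stieltjes_measure_Iic {f : ℝ → ℝ} (hf : Monotone f) (hf0 : ∀ t ≤ 0, f t = 0) (s : ℝ) :
    hf.stieltjesFunction.measure (Iic s) = ENNReal.ofReal (Function.rightLim f s) := by
  rw [StieltjesFunction.measure_Iic (l := 0), sub_zero, hf.stieltjesFunction_eq]
  refine tendsto_const_nhds.congr' ?_
  filter_upwards [eventually_lt_atBot 0] with t ht
  rw [hf.stieltjesFunction_eq]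
  refine (rightLim_eq_of_tendsto (tendsto_const_nhds.congr' ?_)).symm
  filter_upwards [nhdsWithin_le_nhds (Iio_mem_nhds ht)] with x hx using (hf0 x (le_of_lt hx)).symm

lemma ofReal_exp_neg_eq_lintegral (a : ℝ) :
    ENNReal.ofReal (Real.exp (-a)) =
      ∫⁻ u, (Ici a).indicator (fun u => ENNReal.ofReal (Real.exp (-u))) u := by
  rw [lintegral_indicator measurableSet_Ici, setLIntegral_congr Ioi_ae_eq_Ici.symm,
    ← ofReal_integral_eq_lintegral_ofReal (integrableOn_exp_neg_Ioi a)
      (Eventually.of_forall fun u => (Real.exp_pos _).le), integral_exp_neg_Ioi]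

/-- Tonelli, after writing exp(-Xt) as the integral of exp(-u) over u ≥ Xt. -/
lemma lintegral_exp_neg_mul_eq (m : Measure ℝ) [SFinite m] {X : ℝ} (hX : 0 < X) :
    ∫⁻ t, ENNReal.ofReal (Real.exp (-(X * t))) ∂m =
      ∫⁻ u, ENNReal.ofReal (Real.exp (-u)) * m (Iic (u / X)) := by
  rw [lintegral_congr fun t => ofReal_exp_neg_eq_lintegral (X * t), lintegral_lintegral_swap]
  · refine lintegral_congr fun u => ?_
    have : (fun t => (Ici (X * t)).indicator (fun u => ENNReal.ofReal (Real.exp (-u))) u) =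
        (Iic (u / X)).indicator fun _ => ENNReal.ofReal (Real.exp (-u)) := by
      ext t
      simp only [indicator, mem_Ici, mem_Iic, le_div_iff₀ hX, mul_comm]
    rw [this, lintegral_indicator measurableSet_Iic, setLIntegral_const]
  · refine Measurable.aemeasurable ?_
    have : (Function.uncurry fun t u : ℝ =>
        (Ici (X * t)).indicator (fun u => ENNReal.ofReal (Real.exp (-u))) u) =
        {q : ℝ × ℝ | X * q.1 ≤ q.2}.indicator fun q => ENNReal.ofReal (Real.exp (-q.2)) := by
      ext ⟨t, u⟩
      simp [indicator]
    rw [this]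
    exact Measurable.indicator (by fun_prop) (measurableSet_le (by fun_prop) (by fun_prop))

lemma integral_exp_neg_stieltjes {f : ℝ → ℝ} (hf : Monotone f) (hf0 : ∀ t ≤ 0, f t = 0)
    {X : ℝ} (hX : 0 < X) :
    ∫ t, Real.exp (-(X * t)) ∂hf.stieltjesFunction.measure =
      ∫ u in Ioi 0, Real.exp (-u) * f (u / X) := by
  have hnn : ∀ t, 0 ≤ t → 0 ≤ f t := fun t ht => (hf0 0 le_rfl).symm.trans_le (hf ht)
  rw [integral_eq_lintegral_of_nonneg_ae (Eventually.of_forall fun _ => (Real.exp_pos _).le)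
      (by fun_prop),
    integral_eq_lintegral_of_nonneg_ae
      ((ae_restrict_iff' measurableSet_Ioi).2 (Eventually.of_forall fun u hu =>
        mul_nonneg (Real.exp_pos _).le (hnn _ (div_nonneg (le_of_lt hu) hX.le))))
      (by have := hf.measurable; fun_prop), lintegral_exp_neg_mul_eq _ hX]
  congr 1
  rw [← lintegral_indicator measurableSet_Ioi]
  refine lintegral_congr_ae ?_
  -- The distribution function is the right limit of f, which equals f off countably many points.
  have hc : {u | ¬ContinuousAt f (u / X)}.Countable :=
    hf.countable_not_continuousAt.preimage fun a b hab => (div_left_inj' hX.ne').1 hab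
  filter_upwards [hc.ae_notMem volume, (countable_singleton (0 : ℝ)).ae_notMem volume] with u hu hu0
  rw [stieltjes_measure_Iic hf hf0]
  have hcont : ContinuousAt f (u / X) := by simpa using hu
  rw [rightLim_eq_of_tendsto (hcont.tendsto.mono_left nhdsWithin_le_nhds)]
  rcases lt_or_gt_of_ne (show u ≠ 0 from hu0) with h | h
  · rw [hf0 _ (div_nonpos_of_nonpos_of_nonneg h.le hX.le), indicator_of_notMem (by simp [h.le])]
    simp
  · rw [indicator_of_mem (mem_Ioi.2 h), ENNReal.ofReal_mul (Real.exp_pos _).le]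

/-- Every positive nonincreasing regularly varying function is asymptotically the Laplace transform
of a finite measure carried by a prescribed neighbourhood of zero. -/
theorem AntitoneRegVarying.exists_laplace (hk : AntitoneRegVarying k p A) {δ : ℝ} (hδ : 0 < δ) :
    ∃ m : Measure ℝ, IsFiniteMeasure m ∧ m (Icc 0 δ)ᶜ = 0 ∧
      Tendsto (fun X => (∫ t, Real.exp (-(X * t)) ∂m) / k X) atTop (𝓝 1) := by
  -- B ≥ 1/δ makes f constant on [δ, ∞), so no mass lies beyond δ.
  set B := max A δ⁻¹
  have hB : A ≤ B := le_max_left _ _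
  have hB0 : 0 < B := hk.pos_left.trans_le hB
  have hBδ : B⁻¹ ≤ δ := inv_le_of_inv_le₀ hδ (le_max_right _ _)
  set f := recipCutoff k B
  have hf : Monotone f := monotone_recipCutoff hk hB
  have hf0 : ∀ t ≤ 0, f t = 0 := fun t => recipCutoff_of_nonpos
  have hright : ∀ s ≥ δ, Function.rightLim f s = k B := by
    intro s hs
    refine rightLim_eq_of_tendsto (tendsto_const_nhds.congr' ?_)
    filter_upwards [self_mem_nhdsWithin] with x hx
    exact (recipCutoff_of_inv_le hB0 (hBδ.trans (hs.le.trans (le_of_lt hx)))).symm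
  have huniv : hf.stieltjesFunction.measure univ = ENNReal.ofReal (k B) := by
    have h1 := tendsto_measure_iUnion_atTop (μ := hf.stieltjesFunction.measure)
      (s := fun n : ℕ => Iic (n : ℝ)) (fun a b hab => Iic_subset_Iic.2 (by exact_mod_cast hab))
    have h2 : ⋃ n : ℕ, Iic (n : ℝ) = univ := by
      ext x
      simpa using exists_nat_ge x
    rw [h2] at h1
    refine tendsto_nhds_unique h1 (tendsto_const_nhds.congr' ?_)
    obtain ⟨N, hN⟩ := exists_nat_ge δ
    filter_upwards [eventually_ge_atTop N] with n hn
    rw [Function.comp_apply, stieltjes_measure_Iic hf hf0, hright]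
    exact hN.trans (by exact_mod_cast hn)
  have hfin : IsFiniteMeasure hf.stieltjesFunction.measure := ⟨by rw [huniv]; simp⟩
  -- Only the open half line is null: there is an atom at 0 when k has a positive limit at infinity.
  have hneg : hf.stieltjesFunction.measure (Iio 0) = 0 := by
    have : Iio (0 : ℝ) = ⋃ n : ℕ, Iic (-(1 / ((n : ℝ) + 1))) := by
      ext x
      simp only [mem_Iio, mem_iUnion, mem_Iic]
      constructor
      · intro hx
        obtain ⟨n, hn⟩ := exists_nat_one_div_lt (neg_pos.2 hx)
        exact ⟨n, by linarith⟩
      · rintro ⟨n, hn⟩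
        have : 0 < 1 / ((n : ℝ) + 1) := by positivity
        linarith
    rw [this, measure_iUnion_null_iff]
    intro n
    have hn : 0 < 1 / ((n : ℝ) + 1) := by positivity
    rw [stieltjes_measure_Iic hf hf0, rightLim_eq_of_tendsto (y := 0), ENNReal.ofReal_zero]
    refine tendsto_const_nhds.congr' ?_
    filter_upwards [nhdsWithin_le_nhds (Iio_mem_nhds (neg_lt_zero.2 hn))] with x hx
      using (hf0 x (le_of_lt hx)).symm
  have hpos : hf.stieltjesFunction.measure (Ioi δ) = 0 := by
    rw [← compl_Iic, measure_compl measurableSet_Iic (measure_ne_top _ _), huniv,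
      stieltjes_measure_Iic hf hf0, hright δ le_rfl, tsub_self]
  have hΓ : 0 < Real.Gamma (1 - p) := Real.Gamma_pos_of_pos (by linarith [hk.index_nonpos])
  refine ⟨ENNReal.ofReal (Real.Gamma (1 - p))⁻¹ • hf.stieltjesFunction.measure,
    ⟨?_⟩, ?_, ?_⟩
  · rw [Measure.smul_apply, smul_eq_mul]
    exact ENNReal.mul_lt_top ENNReal.ofReal_lt_top (measure_lt_top _ _)
  · rw [Measure.smul_apply, smul_eq_mul, mul_eq_zero]
    right
    refine measure_mono_null (fun x hx => ?_) (measure_union_null hneg hpos)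
    rcases lt_or_ge x 0 with h | h
    · exact Or.inl h
    · exact Or.inr (not_le.1 fun h' => hx ⟨h, h'⟩)
  · have h1 := (tendsto_integral_exp_mul_recipCutoff hk hB).const_mul (Real.Gamma (1 - p))⁻¹
    rw [inv_mul_cancel₀ hΓ.ne'] at h1
    refine h1.congr' ?_
    filter_upwards [eventually_gt_atTop 0] with X hX
    rw [integral_smul_measure, ENNReal.toReal_ofReal (by positivity), smul_eq_mul,
      integral_exp_neg_stieltjes hf hf0 hX, mul_div_assoc]

end recipCutoff

/-! ### Inequalities for single powers. -/

section Scalar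

lemma rpow_le_rpow_neg_two_add_sq {x r : ℝ} (hx : 0 < x) (h1 : -2 ≤ r) (h2 : r ≤ 2) :
    x ^ r ≤ x ^ (-2 : ℝ) + x ^ (2 : ℝ) := by
  have e1 : 0 < x ^ (-2 : ℝ) := Real.rpow_pos_of_pos hx _
  have e2 : 0 < x ^ (2 : ℝ) := Real.rpow_pos_of_pos hx _
  rcases le_total x 1 with h | h
  · linarith [Real.rpow_le_rpow_of_exponent_ge hx h h1]
  · linarith [Real.rpow_le_rpow_of_exponent_le h h2]

/-- Bernoulli's inequality at w and -w gives the lower bound 0. Above, z ↦ z^(a/2) is concave, so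
its tangent at 1, taken at z = (1 ± w)², gives a w². -/
lemma abs_rpow_second_difference_le {a w : ℝ} (ha1 : 1 ≤ a) (ha2 : a ≤ 2) (hw0 : 0 ≤ w)
    (hw1 : w ≤ 1) : |(1 + w) ^ a + (1 - w) ^ a - 2| ≤ 2 * w ^ 2 := by
  have l1 := one_add_mul_self_le_rpow_one_add (s := w) (by linarith) ha1
  have l2 := one_add_mul_self_le_rpow_one_add (s := -w) (by linarith) ha1
  have upper : ∀ y : ℝ, 0 ≤ y → y ^ a ≤ 1 + a / 2 * (y ^ 2 - 1) := by
    intro y hy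
    have := rpow_one_add_le_one_add_mul_self (s := y ^ 2 - 1) (p := a / 2)
      (by nlinarith) (by linarith) (by linarith)
    rwa [add_sub_cancel, ← Real.rpow_natCast_mul hy,
      show ((2 : ℕ) : ℝ) * (a / 2) = a by push_cast; ring] at this
  have u1 := upper (1 + w) (by linarith)
  have u2 := upper (1 - w) (by linarith)
  rw [← sub_eq_add_neg] at l2
  rw [abs_le]
  constructor <;> nlinarith [sq_nonneg w]

/-- For r in [-1, 0], y^r lies between 1 and 1/y, and |1/y - 1| = |y - 1|/y. -/
lemma abs_rpow_sub_one_le {y r : ℝ} (hr1 : -1 ≤ r) (hr0 : r ≤ 0) (hy : 1 / 2 ≤ y) :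
    |y ^ r - 1| ≤ 2 * |y - 1| := by
  have hy0 : 0 < y := by linarith
  rcases le_total 1 y with h | h
  · have h1 := Real.rpow_le_one_of_one_le_of_nonpos h hr0
    have h2 := Real.rpow_le_rpow_of_exponent_le h hr1
    rw [Real.rpow_neg_one] at h2
    rw [abs_of_nonpos (by linarith), abs_of_nonneg (by linarith)]
    have h3 : 1 - (y - 1) ≤ y⁻¹ := by
      rw [← one_div, le_div_iff₀ hy0]
      nlinarith [sq_nonneg (y - 1)]
    linarith
  · have h1 := Real.one_le_rpow_of_pos_of_le_one_of_nonpos hy0 h hr0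
    have h2 := Real.rpow_le_rpow_of_exponent_ge hy0 h hr1
    rw [Real.rpow_neg_one] at h2
    rw [abs_of_nonneg (by linarith), abs_of_nonpos (by linarith)]
    have h3 : y⁻¹ ≤ 1 - 2 * (y - 1) := by
      rw [inv_le_iff_one_le_mul₀ hy0]
      nlinarith
    linarith

end Scalar

/-! ### Mixtures of powers and their regularity. -/

/-- The mixture `x ↦ ∫ |x| ^ s dμ(s)` of fractional Brownian variances. -/
noncomputable def mixture (μ : Measure ℝ) (x : ℝ) : ℝ := ∫ s, |x| ^ s ∂μ

lemma mixture_neg (μ : Measure ℝ) (x : ℝ) : mixture μ (-x) = mixture μ x := by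
  simp [mixture]

lemma mixture_nonneg (μ : Measure ℝ) (x : ℝ) : 0 ≤ mixture μ x :=
  integral_nonneg fun _ => Real.rpow_nonneg (abs_nonneg _) _

/-- The derivative of a mixture on the positive half line. -/
noncomputable def mixtureDeriv (μ : Measure ℝ) (x : ℝ) : ℝ := ∫ s, s * x ^ (s - 1) ∂μ

/-- The second derivative of a mixture on the positive half line. -/
noncomputable def mixtureDeriv₂ (μ : Measure ℝ) (x : ℝ) : ℝ := ∫ s, s * (s - 1) * x ^ (s - 2) ∂μ

lemma mixture_zero {μ : Measure ℝ} {β b : ℝ} (hβ : 1 < β) (hμ : ∀ᵐ s ∂μ, s ∈ Icc β b) : mixture μ 0 = 0 := by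
  refine integral_eq_zero_of_ae ?_
  filter_upwards [hμ] with s hs
  rw [abs_zero, Real.zero_rpow (by linarith [hs.1]), Pi.zero_apply]

lemma mixtureDeriv₂_nonneg {μ : Measure ℝ} {β b : ℝ} (hβ : 1 < β)
    (hμ : ∀ᵐ s ∂μ, s ∈ Icc β b) {x : ℝ} (hx : 0 ≤ x) :
    0 ≤ mixtureDeriv₂ μ x := by
  refine integral_nonneg_of_ae ?_
  filter_upwards [hμ] with s hs
  exact mul_nonneg (mul_nonneg (by linarith [hs.1]) (by linarith [hs.1])) (Real.rpow_nonneg hx _)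

section Mixture

variable {μ : Measure ℝ} [IsFiniteMeasure μ] {β b : ℝ}

lemma measurable_mixture : Measurable (mixture μ) := by
  refine (StronglyMeasurable.integral_prod_right (f := fun x s : ℝ => |x| ^ s) (ν := μ)
    ?_).measurable
  exact Measurable.stronglyMeasurable (by unfold Function.uncurry; fun_prop)

lemma integrable_mul_rpow (hβ : 1 < β) (hb : b < 2) (hμ : ∀ᵐ s ∂μ, s ∈ Icc β b) {g : ℝ → ℝ}
    (hg : Measurable g) {C : ℝ} (hC : ∀ s ∈ Icc β b, |g s| ≤ C) {j : ℝ} (hj0 : 0 ≤ j)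
    (hj2 : j ≤ 2) {x : ℝ} (hx : 0 < x) : Integrable (fun s => g s * x ^ (s - j)) μ := by
  refine Integrable.of_bound (Measurable.aestronglyMeasurable (by fun_prop))
    (C * (x ^ (-2 : ℝ) + x ^ (2 : ℝ))) ?_
  filter_upwards [hμ] with s hs
  rw [norm_mul, Real.norm_eq_abs, Real.norm_of_nonneg (Real.rpow_nonneg hx.le _)]
  exact mul_le_mul (hC s hs)
    (rpow_le_rpow_neg_two_add_sq hx (by linarith [hs.1]) (by linarith [hs.2]))
    (Real.rpow_nonneg hx.le _) ((abs_nonneg _).trans (hC s hs))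

lemma integrable_abs_rpow (hβ : 1 < β) (hb : b < 2) (hμ : ∀ᵐ s ∂μ, s ∈ Icc β b) (x : ℝ) :
    Integrable (fun s => |x| ^ s) μ := by
  rcases eq_or_ne x 0 with rfl | hx
  · refine (integrable_zero ℝ ℝ μ).congr ?_
    filter_upwards [hμ] with s hs
    rw [abs_zero, Real.zero_rpow (by linarith [hs.1]), Pi.zero_apply]
  · have := integrable_mul_rpow hβ hb hμ (g := fun _ => 1) measurable_const (C := 1) (by simp)
      (j := 0) le_rfl zero_le_two (abs_pos.2 hx)
    simpa using this

/-- Differentiation under the integral, dominated on (x/2, 2x). The weights 1 with j = 0 and s with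
j = 1 give the first two derivatives of the mixture. -/
lemma hasDerivAt_integral_rpow (hβ : 1 < β) (hb : b < 2) (hμ : ∀ᵐ s ∂μ, s ∈ Icc β b) {g : ℝ → ℝ}
    (hg : Measurable g) {C : ℝ} (hC : ∀ s ∈ Icc β b, |g s| ≤ C) {j : ℝ} (hj0 : 0 ≤ j)
    (hj1 : j ≤ 1) {x : ℝ} (hx : 0 < x) :
    HasDerivAt (fun y => ∫ s, g s * y ^ (s - j) ∂μ)
      (∫ s, g s * (s - j) * x ^ (s - (j + 1)) ∂μ) x := by
  refine (hasDerivAt_integral_of_dominated_loc_of_deriv_le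
    (F' := fun y s => g s * (s - j) * y ^ (s - (j + 1)))
    (bound := fun _ => C * 2 * ((x / 2) ^ (-2 : ℝ) + (2 * x) ^ (2 : ℝ)))
    (s := Ioo (x / 2) (2 * x)) (Ioo_mem_nhds (by linarith) (by linarith))
    (Eventually.of_forall fun y => Measurable.aestronglyMeasurable (by fun_prop))
    (integrable_mul_rpow hβ hb hμ hg hC hj0 (by linarith) hx)
    (Measurable.aestronglyMeasurable (by fun_prop)) ?_ (integrable_const _) ?_).2
  · filter_upwards [hμ] with s hs y hy
    have hy0 : 0 < y := by linarith [hy.1]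
    have hC0 : 0 ≤ C := (abs_nonneg _).trans (hC s hs)
    rw [norm_mul, norm_mul, Real.norm_eq_abs, Real.norm_eq_abs,
      Real.norm_of_nonneg (Real.rpow_nonneg hy0.le _)]
    have h1 : |s - j| ≤ 2 := abs_le.2 ⟨by linarith [hs.1], by linarith [hs.2]⟩
    have h2 := rpow_le_rpow_neg_two_add_sq hy0 (r := s - (j + 1)) (by linarith [hs.1])
      (by linarith [hs.2])
    have h3 : y ^ (-2 : ℝ) ≤ (x / 2) ^ (-2 : ℝ) :=
      Real.rpow_le_rpow_of_nonpos (by linarith) hy.1.le (by norm_num)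
    have h4 : y ^ (2 : ℝ) ≤ (2 * x) ^ (2 : ℝ) :=
      Real.rpow_le_rpow hy0.le hy.2.le (by norm_num)
    exact mul_le_mul (mul_le_mul (hC s hs) h1 (abs_nonneg _) hC0) (by linarith)
      (Real.rpow_nonneg hy0.le _) (by positivity)
  · filter_upwards with s y hy
    have hy0 : 0 < y := by linarith [hy.1]
    have := (Real.hasDerivAt_rpow_const (p := s - j) (Or.inl hy0.ne')).const_mul (g s)
    rw [sub_sub, ← mul_assoc] at this
    exact this

lemma hasDerivAt_mixture_of_pos (hβ : 1 < β) (hb : b < 2) (hμ : ∀ᵐ s ∂μ, s ∈ Icc β b) {x : ℝ}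
    (hx : 0 < x) : HasDerivAt (mixture μ) (mixtureDeriv μ x) x := by
  have := hasDerivAt_integral_rpow hβ hb hμ (g := fun _ => 1) measurable_const (C := 1) (by simp)
    (j := 0) le_rfl zero_le_one hx
  simp only [sub_zero, one_mul, zero_add] at this
  refine this.congr_of_eventuallyEq ?_
  filter_upwards [lt_mem_nhds hx] with y hy
  rw [mixture, abs_of_pos hy]

lemma hasDerivAt_mixtureDeriv (hβ : 1 < β) (hb : b < 2) (hμ : ∀ᵐ s ∂μ, s ∈ Icc β b) {x : ℝ}
    (hx : 0 < x) : HasDerivAt (mixtureDeriv μ) (mixtureDeriv₂ μ x) x := by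
  have := hasDerivAt_integral_rpow hβ hb hμ (g := fun s => s) measurable_id (C := 2)
    (fun s hs => abs_le.2 ⟨by linarith [hs.1], by linarith [hs.2]⟩) (j := 1) zero_le_one le_rfl hx
  rwa [show (1 : ℝ) + 1 = 2 by norm_num] at this

lemma hasDerivAt_mixture_of_neg (hβ : 1 < β) (hb : b < 2) (hμ : ∀ᵐ s ∂μ, s ∈ Icc β b) {x : ℝ}
    (hx : x < 0) : HasDerivAt (mixture μ) (-mixtureDeriv μ (-x)) x := by
  have := (hasDerivAt_mixture_of_pos hβ hb hμ (neg_pos.2 hx)).comp x (hasDerivAt_neg x)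
  rw [mul_neg_one] at this
  exact this.congr_of_eventuallyEq (Eventually.of_forall fun y => (mixture_neg μ y).symm)

lemma hasDerivAt_deriv_mixture (hβ : 1 < β) (hb : b < 2) (hμ : ∀ᵐ s ∂μ, s ∈ Icc β b) {x : ℝ}
    (hx : x ≠ 0) : HasDerivAt (deriv (mixture μ)) (mixtureDeriv₂ μ |x|) x := by
  rcases lt_or_gt_of_ne hx with h | h
  · have := ((hasDerivAt_mixtureDeriv hβ hb hμ (neg_pos.2 h)).comp x (hasDerivAt_neg x)).neg
    rw [mul_neg_one, neg_neg] at this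
    rw [abs_of_neg h]
    refine this.congr_of_eventuallyEq ?_
    filter_upwards [gt_mem_nhds h] with y hy using (hasDerivAt_mixture_of_neg hβ hb hμ hy).deriv
  · rw [abs_of_pos h]
    refine (hasDerivAt_mixtureDeriv hβ hb hμ h).congr_of_eventuallyEq ?_
    filter_upwards [lt_mem_nhds h] with y hy using (hasDerivAt_mixture_of_pos hβ hb hμ hy).deriv

lemma rho_mixture (hβ : 1 < β) (hb : b < 2) (hμ : ∀ᵐ s ∂μ, s ∈ Icc β b) {x : ℝ} (hx : x ≠ 0) :
    rho (mixture μ) x = 1 / 2 * mixtureDeriv₂ μ |x| := by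
  rw [rho, (hasDerivAt_deriv_mixture hβ hb hμ hx).deriv]

lemma mixture_le_of_abs_le_one (hβ : 1 < β) (hb : b < 2) (hμ : ∀ᵐ s ∂μ, s ∈ Icc β b) {x : ℝ}
    (hx : x ≠ 0) (hx1 : |x| ≤ 1) : mixture μ x ≤ μ.real univ * |x| ^ β := by
  have : mixture μ x ≤ ∫ _, |x| ^ β ∂μ := by
    refine integral_mono_ae (integrable_abs_rpow hβ hb hμ x) (integrable_const _) ?_
    filter_upwards [hμ] with s hs
    exact Real.rpow_le_rpow_of_exponent_ge (abs_pos.2 hx) hx1 hs.1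
  simpa using this

/-- For |x| ≤ 1 the power decreases in the exponent. As b < 2, this lower bound makes x² negligible
against the mixture. -/
lemma le_mixture_of_abs_le_one (hβ : 1 < β) (hb : b < 2) (hμ : ∀ᵐ s ∂μ, s ∈ Icc β b) {x : ℝ}
    (hx : x ≠ 0) (hx1 : |x| ≤ 1) : μ.real univ * |x| ^ b ≤ mixture μ x := by
  have : ∫ _, |x| ^ b ∂μ ≤ mixture μ x := by
    refine integral_mono_ae (integrable_const _) (integrable_abs_rpow hβ hb hμ x) ?_
    filter_upwards [hμ] with s hs
    exact Real.rpow_le_rpow_of_exponent_ge (abs_pos.2 hx) hx1 hs.2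
  simpa using this

lemma eventually_ne_zero_abs_le_one : ∀ᶠ x : ℝ in 𝓝[≠] 0, x ≠ 0 ∧ |x| ≤ 1 := by
  filter_upwards [self_mem_nhdsWithin,
    nhdsWithin_le_nhds (Metric.closedBall_mem_nhds (0 : ℝ) one_pos)] with x hx hx1
  exact ⟨hx, by simpa using hx1⟩

lemma tendsto_abs_rpow_nhdsNE_zero {c : ℝ} (hc : 0 < c) :
    Tendsto (fun x : ℝ => |x| ^ c) (𝓝[≠] 0) (𝓝 0) := by
  have : Continuous fun x : ℝ => |x| ^ c := continuous_abs.rpow_const fun _ => Or.inr hc.le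
  simpa [Real.zero_rpow hc.ne'] using (this.tendsto 0).mono_left nhdsWithin_le_nhds

lemma tendsto_sq_div_mixture (hβ : 1 < β) (hb : b < 2) (hμ : ∀ᵐ s ∂μ, s ∈ Icc β b)
    (hμ0 : μ ≠ 0) : Tendsto (fun x => x ^ 2 / mixture μ x) (𝓝[≠] 0) (𝓝 0) := by
  have hm : 0 < μ.real univ := by
    have := NeZero.mk hμ0
    exact measureReal_univ_pos
  have h1 := (tendsto_abs_rpow_nhdsNE_zero (sub_pos.2 hb)).const_mul (μ.real univ)⁻¹
  rw [mul_zero] at h1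
  refine squeeze_zero' (Eventually.of_forall fun x => div_nonneg (sq_nonneg _)
    (mixture_nonneg _ _)) ?_ h1
  filter_upwards [eventually_ne_zero_abs_le_one] with x ⟨hx, hx1⟩
  have hxp := abs_pos.2 hx
  have hxb := Real.rpow_pos_of_pos hxp b
  have h2 := le_mixture_of_abs_le_one hβ hb hμ hx hx1
  have h3 : x ^ 2 / mixture μ x ≤ x ^ 2 / (μ.real univ * |x| ^ b) := by gcongr
  refine h3.trans_eq ?_
  rw [Real.rpow_sub hxp, Real.rpow_two, sq_abs]
  field_simp

lemma tendsto_mixture_div (hβ : 1 < β) (hb : b < 2) (hμ : ∀ᵐ s ∂μ, s ∈ Icc β b) :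
    Tendsto (fun x => mixture μ x / x) (𝓝[≠] 0) (𝓝 0) := by
  have h1 := (tendsto_abs_rpow_nhdsNE_zero (sub_pos.2 hβ)).const_mul (μ.real univ)
  rw [mul_zero] at h1
  refine squeeze_zero_norm' ?_ h1
  filter_upwards [eventually_ne_zero_abs_le_one] with x ⟨hx, hx1⟩
  have hxp := abs_pos.2 hx
  rw [norm_div, Real.norm_of_nonneg (mixture_nonneg _ _), Real.norm_eq_abs,
    div_le_iff₀ hxp, Real.rpow_sub hxp, Real.rpow_one, mul_assoc, div_mul_cancel₀ _ hxp.ne']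
  exact mixture_le_of_abs_le_one hβ hb hμ hx hx1

/-- Factoring x^s out of the integrand leaves the scalar second difference at w = h/x, bounded
uniformly in s. -/
lemma mixture_second_difference (hβ : 1 < β) (hb : b < 2) (hμ : ∀ᵐ s ∂μ, s ∈ Icc β b) {x h : ℝ}
    (hh : 0 < h) (hhx : h ≤ x / 8) :
    |mixture μ (x + h) + mixture μ (x - h) - 2 * mixture μ x| / h ^ 2 ≤
      2 * (mixture μ x / x ^ 2) := by
  have hx : 0 < x := by linarith
  have i := integrable_abs_rpow hβ hb hμ
  have e : mixture μ (x + h) + mixture μ (x - h) - 2 * mixture μ x =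
      ∫ s, (|x + h| ^ s + |x - h| ^ s - 2 * |x| ^ s) ∂μ := by
    have i2 : Integrable (fun s => |x + h| ^ s + |x - h| ^ s) μ := (i _).add (i _)
    rw [integral_sub i2 ((i _).const_mul 2), integral_add (i _) (i _), integral_const_mul]
    rfl
  have key : |mixture μ (x + h) + mixture μ (x - h) - 2 * mixture μ x| ≤
      ∫ s, 2 * (h / x) ^ 2 * |x| ^ s ∂μ := by
    rw [e, ← Real.norm_eq_abs]
    refine norm_integral_le_of_norm_le ((i x).const_mul _) ?_
    filter_upwards [hμ] with s hs
    have hw := abs_rpow_second_difference_le (a := s) (w := h / x) (by linarith [hs.1])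
      (by linarith [hs.2]) (by positivity) ((div_le_one hx).2 (by linarith))
    have e1 : x + h = x * (1 + h / x) := by field_simp
    have e2 : x - h = x * (1 - h / x) := by field_simp
    have hw1 : 0 ≤ 1 - h / x := by rw [sub_nonneg, div_le_one hx]; linarith
    rw [abs_of_pos hx, abs_of_pos (show 0 < x + h by linarith),
      abs_of_pos (show 0 < x - h by linarith), e1, e2, Real.mul_rpow hx.le (by positivity),
      Real.mul_rpow hx.le hw1, ← mul_add, mul_comm (2 : ℝ) (x ^ s), ← mul_sub, norm_mul,
      Real.norm_of_nonneg (Real.rpow_nonneg hx.le _), Real.norm_eq_abs, mul_comm]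
    exact mul_le_mul_of_nonneg_right hw (Real.rpow_nonneg hx.le _)
  rw [integral_const_mul] at key
  rw [div_le_iff₀ (by positivity)]
  refine key.trans_eq ?_
  rw [← mixture]
  field_simp

lemma abs_mul_sub_one_le (hβ : 1 < β) (hb : b < 2) : ∀ s ∈ Icc β b, |s * (s - 1)| ≤ 2 := by
  intro s hs
  rw [abs_of_nonneg (mul_nonneg (by linarith [hs.1]) (by linarith [hs.1]))]
  nlinarith [hs.1, hs.2]

/-- In x^(s-2) = x^(s-β) / x^(2-β) the numerator is bounded for x ≤ M; hence the choice ζ = 2 - β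
later. -/
lemma mixtureDeriv₂_le (hβ : 1 < β) (hb : b < 2) (hμ : ∀ᵐ s ∂μ, s ∈ Icc β b) {x M : ℝ}
    (hx : 0 < x) (hxM : x ≤ M) :
    mixtureDeriv₂ μ x ≤ μ.real univ * (2 * (max M 1) ^ (2 : ℝ)) / x ^ (2 - β) := by
  have hM : 1 ≤ max M 1 := le_max_right _ _
  have : mixtureDeriv₂ μ x ≤ ∫ _, 2 * (max M 1) ^ (2 : ℝ) / x ^ (2 - β) ∂μ := by
    refine integral_mono_ae (integrable_mul_rpow hβ hb hμ (g := fun s => s * (s - 1))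
      (by fun_prop) (abs_mul_sub_one_le hβ hb) zero_le_two le_rfl hx) (integrable_const _) ?_
    filter_upwards [hμ] with s hs
    have e1 : x ^ (s - 2) = x ^ (s - β) / x ^ (2 - β) := by
      rw [← Real.rpow_sub hx]
      congr 1
      ring
    have e2 : x ^ (s - β) ≤ (max M 1) ^ (2 : ℝ) :=
      (Real.rpow_le_rpow hx.le (hxM.trans (le_max_left _ _)) (by linarith [hs.1])).trans
        (Real.rpow_le_rpow_of_exponent_le hM (by linarith [hs.2]))
    have e3 := (le_abs_self _).trans (abs_mul_sub_one_le hβ hb s hs)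
    rw [e1, ← mul_div_assoc]
    gcongr
  simpa [mul_div_assoc] using this

/-- The integrand of the difference is y^(s-2) - 1 times the nonnegative integrand at x, so the
error is relative to the second derivative itself. -/
lemma abs_mixtureDeriv₂_mul_sub_le (hβ : 1 < β) (hb : b < 2) (hμ : ∀ᵐ s ∂μ, s ∈ Icc β b) {x y : ℝ}
    (hx : 0 < x) (hy : 1 / 2 ≤ y) :
    |mixtureDeriv₂ μ (x * y) - mixtureDeriv₂ μ x| ≤ 2 * |y - 1| * mixtureDeriv₂ μ x := by
  have hy0 : 0 < y := by linarith
  have i : ∀ {x : ℝ}, 0 < x → Integrable (fun s => s * (s - 1) * x ^ (s - 2)) μ := fun hx =>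
    integrable_mul_rpow hβ hb hμ (g := fun s => s * (s - 1))
      (by fun_prop) (abs_mul_sub_one_le hβ hb) zero_le_two le_rfl hx
  unfold mixtureDeriv₂
  rw [← integral_sub (i (mul_pos hx hy0)) (i hx), ← integral_const_mul, ← Real.norm_eq_abs]
  refine norm_integral_le_of_norm_le ((i hx).const_mul _) ?_
  filter_upwards [hμ] with s hs
  have h1 := abs_rpow_sub_one_le (r := s - 2) (by linarith [hs.1]) (by linarith [hs.2]) hy
  have h2 : 0 ≤ s * (s - 1) * x ^ (s - 2) :=
    mul_nonneg (mul_nonneg (by linarith [hs.1]) (by linarith [hs.1])) (Real.rpow_nonneg hx.le _)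
  rw [Real.mul_rpow hx.le hy0.le, show s * (s - 1) * (x ^ (s - 2) * y ^ (s - 2)) -
    s * (s - 1) * x ^ (s - 2) = (y ^ (s - 2) - 1) * (s * (s - 1) * x ^ (s - 2)) by ring,
    norm_mul, Real.norm_of_nonneg h2, Real.norm_eq_abs]
  exact mul_le_mul_of_nonneg_right h1 h2

/-- Scaling x by c only translates log(1/x), to which k is asymptotically insensitive; so the index
is β, whatever p is. -/
lemma regVaryingAtZero_mixture (hβ : 1 < β) (hb : b < 2) (hμ : ∀ᵐ s ∂μ, s ∈ Icc β b)
    (hμ0 : μ ≠ 0) {k : ℝ → ℝ} {p A : ℝ} (hk : AntitoneRegVarying k p A)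
    (hv : mixture μ ~[𝓝[≠] 0] fun x => |x| ^ β * k (Real.log (1 / |x|))) :
    RegVaryingAtZero (mixture μ) β := by
  have hm : 0 < μ.real univ := by
    have := NeZero.mk hμ0
    exact measureReal_univ_pos
  refine ⟨⟨1, one_pos, fun x hx => ?_, measurable_mixture.aemeasurable⟩, fun c hc => ?_⟩
  · refine lt_of_lt_of_le ?_ (le_mixture_of_abs_le_one hβ hb hμ hx.1.ne'
      (by rw [abs_of_pos hx.1]; exact hx.2.le))
    have := Real.rpow_pos_of_pos (abs_pos.2 hx.1.ne') b
    positivity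
  · have hle : 𝓝[>] (0 : ℝ) ≤ 𝓝[≠] 0 := nhdsWithin_mono _ fun x hx => ne_of_gt hx
    have hv1 := hv.mono hle
    have hcl : Tendsto (fun x : ℝ => c * x) (𝓝[>] 0) (𝓝[>] 0) := by
      refine tendsto_nhdsWithin_iff.2 ⟨?_, ?_⟩
      · have : Continuous fun x : ℝ => c * x := by fun_prop
        simpa using (this.tendsto 0).mono_left nhdsWithin_le_nhds
      · filter_upwards [self_mem_nhdsWithin] with x hx using mul_pos hc hx
    have hv2 := hv1.comp_tendsto hcl
    refine (hv2.div hv1).symm.tendsto_nhds ?_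
    have hlog : Tendsto (fun x : ℝ => Real.log (1 / x)) (𝓝[>] 0) atTop := by
      simp_rw [one_div]
      exact Real.tendsto_log_atTop.comp tendsto_inv_nhdsGT_zero
    have h1 := ((hk.tendsto_add (Real.log (1 / c))).comp hlog).const_mul (c ^ β)
    rw [mul_one] at h1
    refine h1.congr' ?_
    filter_upwards [self_mem_nhdsWithin] with x hx
    have hx : 0 < x := hx
    have hxβ := (Real.rpow_pos_of_pos hx β).ne'
    simp only [Function.comp_apply, Pi.div_apply]
    rw [abs_of_pos hx, abs_of_pos (mul_pos hc hx), Real.mul_rpow hc.le hx.le,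
      show (1 : ℝ) / (c * x) = 1 / x * (1 / c) by field_simp,
      Real.log_mul (by positivity) (by positivity)]
    field_simp

theorem incrementConditions_mixture (hβ : 1 < β) (hb : b < 2) (hμ : ∀ᵐ s ∂μ, s ∈ Icc β b)
    (hμ0 : μ ≠ 0) {k : ℝ → ℝ} {p A : ℝ} (hk : AntitoneRegVarying k p A)
    (hv : mixture μ ~[𝓝[≠] 0] fun x => |x| ^ β * k (Real.log (1 / |x|))) :
    IncrementConditions (mixture μ) where
  regVarying := by
    have hβb : β ≤ b := by
      have := ae_neBot.2 hμ0
      obtain ⟨s, hs⟩ := hμ.exists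
      exact hs.1.trans hs.2
    exact ⟨β, hβ.le, by linarith, regVaryingAtZero_mixture hβ hb hμ hμ0 hk hv⟩
  sq_div_tendsto := tendsto_sq_div_mixture hβ hb hμ hμ0
  div_tendsto := tendsto_mixture_div hβ hb hμ
  second_difference := ⟨2, fun _ _ => mixture_second_difference hβ hb hμ⟩
  twice_diff s hs := by
    refine ⟨?_, (hasDerivAt_deriv_mixture hβ hb hμ hs).differentiableAt⟩
    rcases lt_or_gt_of_ne hs with h | h
    · exact (hasDerivAt_mixture_of_neg hβ hb hμ h).differentiableAt
    · exact (hasDerivAt_mixture_of_pos hβ hb hμ h).differentiableAt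
  rho_bounds := by
    have hβ2 : β < 2 := by
      have := ae_neBot.2 hμ0
      obtain ⟨s, hs⟩ := hμ.exists
      exact (hs.1.trans hs.2).trans_lt hb
    refine ⟨2 - β, by linarith, fun M hM => ?_⟩
    set C := μ.real univ * (2 * (max M 1) ^ (2 : ℝ))
    refine ⟨max C 2, fun x hx hxM => ?_, fun x h hx hxh hxM => ?_⟩
    · have hxp := abs_pos.2 hx
      have h1 := mixtureDeriv₂_le hβ hb hμ hxp hxM
      have h0 := mixtureDeriv₂_nonneg hβ hμ hxp.le
      rw [rho_mixture hβ hb hμ hx, abs_of_nonneg (by positivity)]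
      have h2 : C / |x| ^ (2 - β) ≤ max C 2 / |x| ^ (2 - β) := by
        gcongr
        exact le_max_left _ _
      linarith
    · have hxp := abs_pos.2 hx
      have h0 := mixtureDeriv₂_nonneg hβ hμ hxp.le
      have hq : |h / x| ≤ 1 / 4 := by
        rw [abs_div, div_le_iff₀ hxp]
        linarith
      have hy : 3 / 4 ≤ 1 + h / x := by linarith [(abs_le.1 hq).1]
      have e : |x + h| = |x| * (1 + h / x) := by
        rw [← abs_of_pos (show 0 < 1 + h / x by linarith), ← abs_mul]
        congr 1
        field_simp
      have hxh0 : x + h ≠ 0 := by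
        rw [← abs_pos, e]
        exact mul_pos hxp (by linarith)
      have h1 := abs_mixtureDeriv₂_mul_sub_le hβ hb hμ hxp (show 1 / 2 ≤ 1 + h / x by linarith)
      rw [← e, add_sub_cancel_left, abs_div] at h1
      rw [rho_mixture hβ hb hμ hx, rho_mixture hβ hb hμ hxh0, ← mul_sub, abs_mul, abs_mul,
        abs_of_nonneg h0]
      have h2 : 2 * (|h| / |x|) * mixtureDeriv₂ μ |x| ≤
          max C 2 * (|h| / |x|) * mixtureDeriv₂ μ |x| := by
        gcongr
        exact le_max_right _ _
      have h3 : |(1 / 2 : ℝ)| = 1 / 2 := abs_of_pos (by norm_num)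
      rw [h3]
      nlinarith

end Mixture

/-! ### Isonormal Gaussian families on a Hilbert space. -/

section Isonormal

variable {Ω : Type*} [MeasurableSpace Ω] {P : Measure Ω} {H : Type*} [NormedAddCommGroup H]
  [InnerProductSpace ℝ H]

lemma integral_sq_eq_norm_sq (g : Lp ℝ 2 P) : ∫ ω, g ω ^ 2 ∂P = ‖g‖ ^ 2 := by
  rw [← real_inner_self_eq_norm_sq, L2.inner_def]
  simp [sq]

lemma Lp_coeFn_sum_smul {E : Type*} [NormedAddCommGroup E] [NormedSpace ℝ E] {ι : Type*}
    (s : Finset ι) (c : ι → ℝ) (g : ι → Lp E 2 P) :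
    ⇑(∑ i ∈ s, c i • g i) =ᵐ[P] fun ω => ∑ i ∈ s, c i • g i ω := by
  classical
  induction s using Finset.induction_on with
  | empty =>
    simp only [Finset.sum_empty]
    exact Lp.coeFn_zero E 2 P
  | insert i s his ih =>
    rw [Finset.sum_insert his]
    filter_upwards [Lp.coeFn_add (c i • g i) (∑ i ∈ s, c i • g i), Lp.coeFn_smul (c i) (g i), ih]
      with ω h1 h2 h3
    rw [h1, Pi.add_apply, h2, h3, Finset.sum_insert his, Pi.smul_apply]

/-- The map is |t|-Lipschitz because |exp(ia) - exp(ib)| ≤ |a - b| and the L¹ norm is at most the L²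
norm. It lets the Gaussian law pass from a dense subspace to its closure. -/
lemma continuous_integral_exp_Lp [IsProbabilityMeasure P] (t : ℝ) :
    Continuous fun g : Lp ℝ 2 P => ∫ ω, Complex.exp (t * g ω * Complex.I) ∂P := by
  have hint : ∀ g : Lp ℝ 2 P, Integrable (fun ω => Complex.exp (t * g ω * Complex.I)) P := by
    intro g
    refine Integrable.of_bound (C := 1) ?_ (Eventually.of_forall fun ω => ?_)
    · have := (Lp.aestronglyMeasurable g).aemeasurable
      exact AEMeasurable.aestronglyMeasurable (by fun_prop)
    · rw [← Complex.ofReal_mul, Complex.norm_exp_ofReal_mul_I]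
  refine LipschitzWith.continuous (K := ‖t‖₊) (LipschitzWith.of_dist_le_mul fun f g => ?_)
  have hfg : Integrable (fun ω => (f - g) ω) P := (Lp.memLp (f - g)).integrable one_le_two
  rw [dist_eq_norm, dist_eq_norm, ← integral_sub (hint f) (hint g)]
  have h1 : ‖∫ ω, (Complex.exp (t * f ω * Complex.I) - Complex.exp (t * g ω * Complex.I)) ∂P‖ ≤
      ∫ ω, |t| * ‖(f - g) ω‖ ∂P := by
    refine norm_integral_le_of_norm_le (hfg.norm.const_mul _) ?_
    filter_upwards [Lp.coeFn_sub f g] with ω hω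
    rw [hω, Pi.sub_apply, Real.norm_eq_abs, ← abs_mul]
    have e : Complex.exp (t * f ω * Complex.I) - Complex.exp (t * g ω * Complex.I) =
        Complex.exp ((t * g ω : ℝ) * Complex.I) *
          (Complex.exp (Complex.I * (t * (f ω - g ω) : ℝ)) - 1) := by
      rw [mul_sub, ← Complex.exp_add, mul_one]
      push_cast
      ring_nf
    rw [e, norm_mul, Complex.norm_exp_ofReal_mul_I, one_mul]
    exact Real.norm_exp_I_mul_ofReal_sub_one_le
  refine h1.trans ?_
  rw [integral_const_mul, coe_nnnorm, Real.norm_eq_abs]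
  refine mul_le_mul_of_nonneg_left ?_ (abs_nonneg _)
  rw [integral_norm_eq_lintegral_enorm hfg.aestronglyMeasurable, ← eLpNorm_one_eq_lintegral_enorm,
    Lp.norm_def]
  exact ENNReal.toReal_mono (Lp.eLpNorm_ne_top _)
    (eLpNorm_le_eLpNorm_of_exponent_le one_le_two (Lp.aestronglyMeasurable _))

/-- Every real Hilbert space is isometric to a space of centred Gaussian random variables. -/
theorem exists_isonormal (H : Type) [NormedAddCommGroup H] [InnerProductSpace ℝ H]
    [CompleteSpace H] :
    ∃ (Ω : Type) (_ : MeasurableSpace Ω) (P : Measure Ω) (_ : IsProbabilityMeasure P)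
      (W : H →ₗᵢ[ℝ] Lp ℝ 2 P), ∀ f, P.map (W f) = gaussianReal 0 (‖f‖₊ ^ 2) := by
  classical
  obtain ⟨w, b, -⟩ := exists_hilbertBasis ℝ H
  set P : Measure (w → ℝ) := Measure.infinitePi fun _ => gaussianReal 0 1
  have hmap : ∀ i, P.map (Function.eval i) = gaussianReal 0 1 := fun i =>
    (measurePreserving_eval_infinitePi (fun _ : w => gaussianReal 0 1) i).map_eq
  have hlaw : ∀ i, HasLaw (Function.eval i) (gaussianReal 0 1) P := fun i =>
    ⟨(measurable_pi_apply i).aemeasurable, hmap i⟩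
  have hindep : ∀ c : w → ℝ, iIndepFun (fun i (ω : w → ℝ) => c i * ω i) P := fun c =>
    iIndepFun_infinitePi (P := fun _ : w => gaussianReal 0 1) (X := fun i x => c i * x)
      fun i => by fun_prop
  have hmem : ∀ i, MemLp (fun ω : w → ℝ => ω i) 2 P := fun i => by
    have := memLp_id_gaussianReal (μ := 0) (v := 1) 2
    rw [← hmap i] at this
    exact this.comp_of_map (measurable_pi_apply i).aemeasurable
  have hmean : ∀ i, ∫ ω : w → ℝ, ω i ∂P = 0 := fun i => by
    have := (hlaw i).integral_eq
    rw [integral_id_gaussianReal] at this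
    exact this
  have hvar : ∀ i, ∫ ω : w → ℝ, ω i ^ 2 ∂P = 1 := fun i => by
    have h1 := (hlaw i).variance_eq
    rw [variance_id_gaussianReal, variance_of_integral_eq_zero (hlaw i).aemeasurable (hmean i)]
      at h1
    exact_mod_cast h1
  set ξ : w → Lp ℝ 2 P := fun i => (hmem i).toLp _
  have hξ : ∀ i, ξ i =ᵐ[P] fun ω => ω i := fun i => (hmem i).coeFn_toLp
  have hON : Orthonormal ℝ ξ := by
    refine ⟨fun i => ?_, fun i j hij => ?_⟩
    · have h1 : ‖ξ i‖ ^ 2 = 1 := by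
        rw [← integral_sq_eq_norm_sq, ← hvar i]
        refine integral_congr_ae ?_
        filter_upwards [hξ i] with ω h
        rw [h]
      exact (pow_eq_one_iff_of_nonneg (norm_nonneg _) two_ne_zero).1 h1
    · change inner ℝ (ξ i) (ξ j) = 0
      rw [L2.inner_def]
      have h1 : ∫ ω, inner ℝ (ξ i ω) (ξ j ω) ∂P = ∫ ω, ω i * ω j ∂P := by
        refine integral_congr_ae ?_
        filter_upwards [hξ i, hξ j] with ω h h'
        rw [h, h']
        simp [mul_comm]
      have h2 : IndepFun (fun ω : w → ℝ => ω i) (fun ω => ω j) P := by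
        have := (hindep fun _ => 1).indepFun hij
        simpa using this
      rw [h1, h2.integral_fun_mul_eq_mul_integral (hmem i).aestronglyMeasurable
        (hmem j).aestronglyMeasurable, hmean i, zero_mul]
  -- The independent standard Gaussian coordinates are orthonormal in L²; W sends the Hilbert basis
  -- to them.
  set W : H →ₗᵢ[ℝ] Lp ℝ 2 P :=
    hON.orthogonalFamily.linearIsometry.comp b.repr.toLinearIsometry
  have hWb : ∀ i, W (b i) = ξ i := fun i => by
    change hON.orthogonalFamily.linearIsometry (b.repr (b i)) = ξ i
    rw [b.repr_self, OrthogonalFamily.linearIsometry_apply_single]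
    simp
  -- Both sides are continuous in f, so it is enough to check finite combinations of basis vectors,
  -- which become sums of independent Gaussians.
  have hchar : ∀ (f : H) (t : ℝ), ∫ ω, Complex.exp (t * W f ω * Complex.I) ∂P =
      Complex.exp (-((‖f‖ : ℂ) ^ 2 * (t : ℂ) ^ 2 / 2)) := by
    intro f t
    have hclosed : IsClosed {f : H | ∫ ω, Complex.exp (t * W f ω * Complex.I) ∂P =
        Complex.exp (-((‖f‖ : ℂ) ^ 2 * (t : ℂ) ^ 2 / 2))} :=
      isClosed_eq ((continuous_integral_exp_Lp t).comp W.continuous) (by fun_prop)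
    have hspan : ∀ f ∈ Submodule.span ℝ (range b), f ∈ {f : H |
        ∫ ω, Complex.exp (t * W f ω * Complex.I) ∂P =
          Complex.exp (-((‖f‖ : ℂ) ^ 2 * (t : ℂ) ^ 2 / 2))} := by
      intro f hf
      obtain ⟨c, rfl⟩ := Finsupp.mem_span_range_iff_exists_finsupp.1 hf
      set f := c.sum fun i a => a • b i
      have hWf : W f = ∑ i ∈ c.support, c i • ξ i := by
        simp only [f, Finsupp.sum, map_sum, map_smul, hWb]
      have hWae : W f =ᵐ[P] fun ω => ∑ i : c.support, c i * ω i := by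
        rw [hWf]
        filter_upwards [Lp_coeFn_sum_smul c.support c ξ,
          (Finset.eventually_all c.support).2 fun i _ => hξ i] with ω h1 h2
        rw [h1, Finset.sum_coe_sort c.support fun i => c i * ω i]
        exact Finset.sum_congr rfl fun i hi => by rw [h2 i hi, smul_eq_mul]
      have hG : HasGaussianLaw (W f) P := by
        refine HasGaussianLaw.congr ?_ hWae.symm
        refine iIndepFun.hasGaussianLaw_fun_sum (X := fun (i : c.support) (ω : w → ℝ) => c i * ω i)
          (fun i => ?_) ((hindep c).precomp Subtype.val_injective)
        exact (hlaw i).hasGaussianLaw.fun_smul (c i)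
      have hmean0 : ∫ ω, W f ω ∂P = 0 := by
        rw [integral_congr_ae hWae, integral_finsetSum]
        · exact Finset.sum_eq_zero fun i _ => by rw [integral_const_mul, hmean, mul_zero]
        · exact fun i _ => ((hmem i).integrable one_le_two).const_mul _
      have h3 := hG.map_eq_gaussianReal
      rw [hmean0, variance_of_integral_eq_zero hG.aemeasurable hmean0,
        integral_sq_eq_norm_sq, W.norm_map] at h3
      have h4 := charFun_gaussianReal (μ := 0) (v := (‖f‖ ^ 2).toNNReal) t
      rw [← h3, charFun_apply_real, integral_map hG.aemeasurable
        (Measurable.aestronglyMeasurable (by fun_prop)), Real.coe_toNNReal _ (sq_nonneg _)] at h4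
      rw [mem_ofPred_eq, h4]
      simp
    have hdense : closure (Submodule.span ℝ (range b) : Set H) = univ := by
      rw [← Submodule.topologicalClosure_coe, b.dense_span]
      rfl
    exact closure_minimal hspan hclosed (hdense ▸ mem_univ f)
  refine ⟨w → ℝ, inferInstance, P, inferInstance, W, fun f => ?_⟩
  have hae : AEMeasurable (W f) P := (Lp.aestronglyMeasurable _).aemeasurable
  have : IsProbabilityMeasure (P.map (W f)) := Measure.isProbabilityMeasure_map hae
  refine Measure.ext_of_charFun (funext fun t => ?_)
  rw [charFun_apply_real, integral_map hae (Measurable.aestronglyMeasurable (by fun_prop)), hchar,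
    charFun_gaussianReal]
  simp

end Isonormal

/-! ### Gaussian processes from curves in a Hilbert space. -/

section IsonormalProcess

variable {Ω : Type*} [MeasurableSpace Ω] {P : Measure Ω} {H : Type*} [NormedAddCommGroup H]
  [InnerProductSpace ℝ H] {W : H →ₗᵢ[ℝ] Lp ℝ 2 P}

lemma aemeasurable_isonormal (W : H →ₗᵢ[ℝ] Lp ℝ 2 P) (f : H) : AEMeasurable (W f) P :=
  (Lp.aestronglyMeasurable _).aemeasurable

lemma isonormal_sub_ae (W : H →ₗᵢ[ℝ] Lp ℝ 2 P) (f g : H) :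
    W (f - g) =ᵐ[P] fun ω => W f ω - W g ω := by
  rw [map_sub]
  exact Lp.coeFn_sub _ _

/-- By linearity a functional of the vector (W(φ i)) is a.e. W of one combination of the φ i. This
gives joint Gaussianity, and shows that norms of combinations determine the joint law. -/
lemma map_dual_isonormal (hW : ∀ f, P.map (W f) = gaussianReal 0 (‖f‖₊ ^ 2)) {ι : Type*}
    [Fintype ι] [DecidableEq ι] (φ : ι → H) (L : StrongDual ℝ (ι → ℝ)) :
    (P.map fun ω i => W (φ i) ω).map L =
      gaussianReal 0 (‖∑ i, L (fun j => if i = j then 1 else 0) • φ i‖₊ ^ 2) := by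
  rw [← hW, AEMeasurable.map_map_of_aemeasurable L.continuous.aemeasurable
    (aemeasurable_pi_lambda _ fun i => aemeasurable_isonormal W (φ i))]
  refine Measure.map_congr ?_
  rw [map_sum]
  simp_rw [map_smul]
  filter_upwards [Lp_coeFn_sum_smul Finset.univ
    (fun i => L fun j => if i = j then 1 else 0) fun i => W (φ i)] with ω hω
  rw [hω, Function.comp_apply]
  have := LinearMap.pi_apply_eq_sum_univ L.toLinearMap fun i => W (φ i) ω
  rw [ContinuousLinearMap.coe_coe] at this
  rw [this]
  exact Finset.sum_congr rfl fun i _ => by simp [mul_comm]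

lemma isGaussianProcess_isonormal (hW : ∀ f, P.map (W f) = gaussianReal 0 (‖f‖₊ ^ 2)) {T : Type*}
    (φ : T → H) : IsGaussianProcess (fun t => W (φ t)) P := by
  classical
  exact ⟨fun I => ⟨isGaussian_of_map_eq_gaussianReal fun L =>
    ⟨_, _, map_dual_isonormal hW (fun i : I => φ i) L⟩⟩⟩

lemma map_isonormal_eq_of_norm_eq [IsProbabilityMeasure P]
    (hW : ∀ f, P.map (W f) = gaussianReal 0 (‖f‖₊ ^ 2)) {ι : Type*} [Fintype ι] {φ ψ : ι → H}
    (h : ∀ c : ι → ℝ, ‖∑ i, c i • φ i‖ = ‖∑ i, c i • ψ i‖) :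
    (P.map fun ω i => W (φ i) ω) = P.map fun ω i => W (ψ i) ω := by
  classical
  have h1 : ∀ φ : ι → H, IsProbabilityMeasure (P.map fun ω i => W (φ i) ω) := fun φ =>
    Measure.isProbabilityMeasure_map
      (aemeasurable_pi_lambda _ fun i => aemeasurable_isonormal W (φ i))
  have := h1 φ
  have := h1 ψ
  refine Measure.ext_of_charFunDual (funext fun L => ?_)
  have h2 : ‖∑ i, L (fun j => if i = j then 1 else 0) • φ i‖₊ =
      ‖∑ i, L (fun j => if i = j then 1 else 0) • ψ i‖₊ :=
    NNReal.eq (h fun i => L fun j => if i = j then 1 else 0)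
  rw [charFunDual_eq_charFun_map_one, charFunDual_eq_charFun_map_one, map_dual_isonormal hW,
    map_dual_isonormal hW, h2]

/-- A curve in a Hilbert space whose increments are stationary up to isometry yields a Gaussian
process with stationary increments. -/
theorem isStationaryIncrementGaussian_isonormal [IsProbabilityMeasure P]
    (hW : ∀ f, P.map (W f) = gaussianReal 0 (‖f‖₊ ^ 2)) {f : ℝ≥0 → H} {v : ℝ → ℝ}
    (hv : ∀ x y : ℝ≥0, ‖f x - f y‖ ^ 2 = v (x - y))
    (hstat : ∀ (t : ℝ≥0) (I : Finset ℝ≥0) (c : I → ℝ),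
      ‖∑ i : I, c i • (f (t + i) - f t)‖ = ‖∑ i : I, c i • (f i - f 0)‖) :
    IsStationaryIncrementGaussian P (fun x ω => W (f x) ω - W (f 0) ω) v where
  gaussian := (isGaussianProcess_isonormal hW fun x => f x - f 0).congr
    fun x => isonormal_sub_ae W (f x) (f 0)
  -- The process is defined as the difference W(f x) - W(f 0) of representatives, so it vanishes at
  -- 0 for every ω, not just almost surely.
  zero ω := sub_self _
  mean_zero x := by
    have h1 := integral_map (aemeasurable_isonormal W (f x - f 0)) (f := fun y : ℝ => y)
      measurable_id.aestronglyMeasurable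
    rw [hW, integral_id_gaussianReal] at h1
    rw [← integral_congr_ae (isonormal_sub_ae W (f x) (f 0)), ← h1]
  stationary t I := by
    have h1 : (fun ω (x : I) => W (f (t + x) - f t) ω) =ᵐ[P]
        fun ω (x : I) => (W (f (t + x)) ω - W (f 0) ω) - (W (f t) ω - W (f 0) ω) := by
      filter_upwards [ae_all_iff.2 fun x : I => isonormal_sub_ae W (f (t + x)) (f t)] with ω hω
      funext x
      rw [hω x, sub_sub_sub_cancel_right]
    have h2 : (fun ω (x : I) => W (f x - f 0) ω) =ᵐ[P]
        fun ω (x : I) => (W (f x) ω - W (f 0) ω) - (W (f 0) ω - W (f 0) ω) := by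
      filter_upwards [ae_all_iff.2 fun x : I => isonormal_sub_ae W (f x) (f 0)] with ω hω
      funext x
      rw [hω x, sub_self, sub_zero]
    have m : ∀ φ : I → H, AEMeasurable (fun ω i => W (φ i) ω) P := fun φ =>
      aemeasurable_pi_lambda _ fun i => aemeasurable_isonormal W (φ i)
    refine ⟨(m _).congr h1, (m _).congr h2, ?_⟩
    rw [← Measure.map_congr h1, ← Measure.map_congr h2]
    exact map_isonormal_eq_of_norm_eq hW (hstat t I)
  variance_eq x y := by
    rw [← hv, ← W.norm_map, ← integral_sq_eq_norm_sq]
    refine integral_congr_ae ?_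
    filter_upwards [isonormal_sub_ae W (f x) (f y)] with ω hω
    rw [hω, sub_sub_sub_cancel_right]

end IsonormalProcess

/-! ### Spectral representation. -/

section Spectral

/-- The spectral representation: if `v x = ∫ ‖exp (i λ x) - 1‖² dν(λ)`, then `v` is the increments
variance of a centred Gaussian process with stationary increments. -/
theorem exists_gaussian_of_spectral {ν : Measure ℝ} {v : ℝ → ℝ} (hv0 : ∀ x, 0 ≤ v x)
    (hv : ∀ x : ℝ, ∫⁻ l, ‖Complex.exp (Complex.I * (l * x : ℝ)) - 1‖ₑ ^ 2 ∂ν =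
      ENNReal.ofReal (v x)) :
    ∃ (Ω : Type) (_ : MeasurableSpace Ω) (P : Measure Ω) (_ : IsProbabilityMeasure P)
      (G : ℝ≥0 → Ω → ℝ), IsStationaryIncrementGaussian P G v := by
  set e : ℝ → ℝ → ℂ := fun x l => Complex.exp (Complex.I * (l * x : ℝ)) with he
  have hnorm : ∀ x l, ‖e x l‖ = 1 := fun x l => by
    simp only [he]
    rw [mul_comm, Complex.norm_exp_ofReal_mul_I]
  have hadd : ∀ x y l, e (x + y) l = e x l * e y l := fun x y l => by
    simp only [he]
    rw [← Complex.exp_add, mul_add, Complex.ofReal_add, mul_add]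
  have hzero : ∀ l, e 0 l = 1 := fun l => by simp [he]
  have hmeas : ∀ x, Measurable (e x) := fun x => by fun_prop
  have hL : ∀ x, eLpNorm (fun l => e x l - 1) 2 ν ^ 2 = ENNReal.ofReal (v x) := fun x => by
    rw [← hv, eLpNorm_eq_lintegral_rpow_enorm_toReal two_ne_zero ENNReal.ofNat_ne_top,
      ← ENNReal.rpow_natCast, ← ENNReal.rpow_mul]
    simp [he]
  have hmem : ∀ x, MemLp (fun l => e x l - 1) 2 ν := fun x => by
    refine ⟨((hmeas x).sub_const 1).aestronglyMeasurable, ?_⟩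
    by_contra hc
    have := hL x
    rw [not_lt_top_iff.1 hc] at this
    simp at this
  set f : ℝ≥0 → Lp ℂ 2 ν := fun x => (hmem x).toLp _
  have hf : ∀ x : ℝ≥0, f x =ᵐ[ν] fun l => e x l - 1 := fun x => (hmem x).coeFn_toLp
  have hf0 : ∀ x : ℝ≥0, ∀ᵐ l ∂ν, (f x - f 0) l = e x l - 1 := fun x => by
    filter_upwards [Lp.coeFn_sub (f x) (f 0), hf x, hf 0] with l h1 h2 h3
    rw [h1, Pi.sub_apply, h2, h3]
    simp [hzero]
  have hfd : ∀ t x : ℝ≥0, ∀ᵐ l ∂ν, (f (t + x) - f t) l = e t l * (e x l - 1) := fun t x => by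
    filter_upwards [Lp.coeFn_sub (f (t + x)) (f t), hf (t + x), hf t] with l h1 h2 h3
    rw [h1, Pi.sub_apply, h2, h3, NNReal.coe_add, hadd]
    ring
  have hnormv : ∀ x y : ℝ≥0, ‖f x - f y‖ ^ 2 = v (x - y) := fun x y => by
    rw [Lp.norm_def, ← ENNReal.toReal_pow, ← ENNReal.toReal_ofReal (hv0 _), ← hL]
    congr 2
    refine eLpNorm_congr_norm_ae ?_
    filter_upwards [Lp.coeFn_sub (f x) (f y), hf x, hf y] with l h1 h2 h3
    have h4 : e x l - 1 - (e y l - 1) = e y l * (e (x - y) l - 1) := by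
      rw [mul_sub, ← hadd]
      ring_nf
    rw [h1, Pi.sub_apply, h2, h3, h4, norm_mul, hnorm, one_mul]
  -- Starting the increments at t multiplies them by the unimodular function `e t`, an isometry of
  -- L².
  have hstat : ∀ (t : ℝ≥0) (I : Finset ℝ≥0) (c : I → ℝ),
      ‖∑ i : I, c i • (f (t + i) - f t)‖ = ‖∑ i : I, c i • (f i - f 0)‖ := fun t I c => by
    rw [Lp.norm_def, Lp.norm_def]
    congr 1
    refine eLpNorm_congr_norm_ae ?_
    filter_upwards [Lp_coeFn_sum_smul Finset.univ c fun i : I => f (t + i) - f t,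
      Lp_coeFn_sum_smul Finset.univ c fun i : I => f i - f 0,
      ae_all_iff.2 fun i : I => hfd t i, ae_all_iff.2 fun i : I => hf0 i] with l h1 h2 h3 h4
    have h5 : ∑ i : I, c i • (f (t + i) - f t) l =
        e t l * ∑ i : I, c i • (f i - f 0) l := by
      rw [Finset.mul_sum]
      exact Finset.sum_congr rfl fun i _ => by rw [h3 i, h4 i, mul_smul_comm]
    rw [h1, h2, h5, norm_mul, hnorm, one_mul]
  obtain ⟨Ω, mΩ, P, hP, W, hW⟩ := exists_isonormal (Lp ℂ 2 ν)
  exact ⟨Ω, mΩ, P, hP, _, isStationaryIncrementGaussian_isonormal hW hnormv hstat⟩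

end Spectral

/-! ### Spectral measure of a mixture. -/

section FractionalSpectrum

/-- The squared modulus of `exp (i l) - 1`. -/
noncomputable def spectralKernel (l : ℝ) : ℝ := (2 * Real.sin (l / 2)) ^ 2

lemma measurable_spectralKernel : Measurable spectralKernel := by
  unfold spectralKernel
  fun_prop

lemma spectralKernel_nonneg (l : ℝ) : 0 ≤ spectralKernel l := sq_nonneg _

lemma spectralKernel_zero : spectralKernel 0 = 0 := by simp [spectralKernel]

lemma spectralKernel_neg (l : ℝ) : spectralKernel (-l) = spectralKernel l := by
  simp [spectralKernel, neg_div]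

lemma spectralKernel_mul_abs (l x : ℝ) : spectralKernel (l * |x|) = spectralKernel (l * x) := by
  rcases abs_choice x with h | h <;> rw [h]
  rw [mul_neg, spectralKernel_neg]

lemma enorm_exp_sub_one_sq (l : ℝ) :
    ‖Complex.exp (Complex.I * l) - 1‖ₑ ^ 2 = ENNReal.ofReal (spectralKernel l) := by
  rw [← ofReal_norm, Complex.norm_exp_I_mul_ofReal_sub_one, ← ENNReal.ofReal_pow (norm_nonneg _),
    Real.norm_eq_abs, sq_abs, spectralKernel]

lemma spectralKernel_le_sq (l : ℝ) : spectralKernel l ≤ l ^ 2 := by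
  refine sq_le_sq.2 ?_
  have := Real.abs_sin_le_abs (x := l / 2)
  rw [abs_mul, abs_two]
  rw [abs_div, abs_two] at this
  linarith

lemma spectralKernel_le_four (l : ℝ) : spectralKernel l ≤ 4 := by
  unfold spectralKernel
  nlinarith [Real.sin_sq_le_one (l / 2)]

lemma spectralKernel_pos {l : ℝ} (h0 : 0 < l) (h1 : l < 1) : 0 < spectralKernel l := by
  have := Real.sin_pos_of_pos_of_lt_pi (x := l / 2) (by linarith) (by linarith [Real.pi_gt_three])
  unfold spectralKernel
  positivity

/-- The normalising constant of the spectral density of fractional Brownian motion. -/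
noncomputable def fbConst (s : ℝ) : ℝ≥0∞ :=
  ∫⁻ l in Ioi 0, ENNReal.ofReal (l ^ (-1 - s)) * ENNReal.ofReal (spectralKernel l)

lemma measurable_fbConst : Measurable fbConst := by
  have := measurable_spectralKernel
  unfold fbConst
  refine Measurable.lintegral_prod_right' (f := fun q : ℝ × ℝ =>
    ENNReal.ofReal (q.2 ^ (-1 - q.1)) * ENNReal.ofReal (spectralKernel q.2)) ?_
  fun_prop

lemma fbConst_ne_zero (s : ℝ) : fbConst s ≠ 0 := by
  have := measurable_spectralKernel
  rw [← pos_iff_ne_zero, fbConst, setLIntegral_pos_iff (by fun_prop)]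
  refine lt_of_lt_of_le ?_ (measure_mono (s := Ioo (0 : ℝ) 1) fun l hl => ⟨?_, hl.1⟩)
  · simp
  · exact (ENNReal.mul_pos (ENNReal.ofReal_pos.2 (Real.rpow_pos_of_pos hl.1 _)).ne'
      (ENNReal.ofReal_pos.2 (spectralKernel_pos hl.1 hl.2)).ne').ne'

/-- Near 0 the kernel is at most l², leaving l^(1-s), integrable as s < 2; beyond 1 it is at most 4,
leaving l^(-1-s), integrable as s > 0. -/
lemma fbConst_ne_top {s : ℝ} (h0 : 0 < s) (h2 : s < 2) : fbConst s ≠ ∞ := by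
  have hk := measurable_spectralKernel
  have h1 : IntegrableOn (fun l : ℝ => l ^ (-1 - s) * spectralKernel l) (Ioc 0 1) := by
    have i : IntegrableOn (fun l : ℝ => l ^ (1 - s)) (Ioc 0 1) :=
      (intervalIntegral.intervalIntegrable_rpow' (by linarith)).1
    refine i.mono' (Measurable.aestronglyMeasurable (by fun_prop)) ?_
    refine (ae_restrict_iff' measurableSet_Ioc).2 (Eventually.of_forall fun l hl => ?_)
    have hl0 : 0 < l := hl.1
    rw [norm_mul, Real.norm_of_nonneg (Real.rpow_nonneg hl0.le _),
      Real.norm_of_nonneg (spectralKernel_nonneg l)]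
    refine (mul_le_mul_of_nonneg_left (spectralKernel_le_sq l)
      (Real.rpow_nonneg hl0.le _)).trans_eq ?_
    rw [← Real.rpow_two, ← Real.rpow_add hl0]
    ring_nf
  have h3 : IntegrableOn (fun l : ℝ => l ^ (-1 - s) * spectralKernel l) (Ioi 1) := by
    have i : IntegrableOn (fun l : ℝ => l ^ (-1 - s)) (Ioi 1) :=
      integrableOn_Ioi_rpow_of_lt (by linarith) one_pos
    refine (i.mul_const 4).mono' (Measurable.aestronglyMeasurable (by fun_prop)) ?_
    refine (ae_restrict_iff' measurableSet_Ioi).2 (Eventually.of_forall fun l hl => ?_)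
    have hl0 : 0 < l := one_pos.trans hl
    rw [norm_mul, Real.norm_of_nonneg (Real.rpow_nonneg hl0.le _),
      Real.norm_of_nonneg (spectralKernel_nonneg l)]
    exact mul_le_mul_of_nonneg_left (spectralKernel_le_four l) (Real.rpow_nonneg hl0.le _)
  have h4 := h1.union h3
  rw [Ioc_union_Ioi_eq_Ioi zero_le_one] at h4
  refine ne_of_eq_of_ne ?_ h4.lintegral_lt_top.ne
  refine setLIntegral_congr_fun measurableSet_Ioi fun l hl => ?_
  rw [ENNReal.ofReal_mul (Real.rpow_nonneg (le_of_lt hl) _)]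

lemma lintegral_Ioi_eq_comp_mul {x : ℝ} (hx : 0 < x) {F : ℝ → ℝ≥0∞} (hF : Measurable F) :
    ∫⁻ l in Ioi 0, F l = ENNReal.ofReal x * ∫⁻ l in Ioi 0, F (l * x) := by
  have h1 : ∫⁻ l, (Ioi 0).indicator F l =
      ENNReal.ofReal x * ∫⁻ l, (Ioi 0).indicator F (l * x) := by
    conv_lhs => rw [← Real.smul_map_volume_mul_right hx.ne', lintegral_smul_measure,
      lintegral_map (hF.indicator measurableSet_Ioi) (by fun_prop), abs_of_pos hx]
    rfl
  rw [← lintegral_indicator measurableSet_Ioi, h1, ← lintegral_indicator measurableSet_Ioi]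
  congr 2
  ext l
  simp [indicator, hx]

lemma lintegral_spectralKernel_mul {x s : ℝ} (hx : x ≠ 0) :
    ∫⁻ l in Ioi 0, ENNReal.ofReal (l ^ (-1 - s)) * ENNReal.ofReal (spectralKernel (l * x)) =
      ENNReal.ofReal (|x| ^ s) * fbConst s := by
  have hk := measurable_spectralKernel
  have hx0 := abs_pos.2 hx
  have h1 := lintegral_Ioi_eq_comp_mul hx0 (F := fun l => ENNReal.ofReal (l ^ (-1 - s)) *
    ENNReal.ofReal (spectralKernel l)) (by fun_prop)
  rw [fbConst, h1, ← mul_assoc, ← lintegral_const_mul _ (by fun_prop)]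
  refine setLIntegral_congr_fun measurableSet_Ioi fun l hl => ?_
  have hl0 : 0 < l := hl
  rw [spectralKernel_mul_abs, ← mul_assoc (ENNReal.ofReal (|x| ^ s) * ENNReal.ofReal |x|),
    ← ENNReal.ofReal_mul (p := |x| ^ s) (by positivity),
    ← ENNReal.ofReal_mul (p := |x| ^ s * |x|) (by positivity), Real.mul_rpow hl0.le hx0.le]
  congr 2
  have : |x| ^ s * |x| * |x| ^ (-1 - s) = 1 := by
    nth_rewrite 2 [← Real.rpow_one |x|]
    rw [← Real.rpow_add hx0, ← Real.rpow_add hx0, show s + 1 + (-1 - s) = 0 by ring,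
      Real.rpow_zero]
  linear_combination -(l ^ (-1 - s)) * this

/-- The spectral measure of a mixture of fractional Brownian variances. -/
noncomputable def mixtureSpectrum (μ : Measure ℝ) : Measure ℝ :=
  (volume.restrict (Ioi 0)).withDensity fun l =>
    ∫⁻ s, ENNReal.ofReal (l ^ (-1 - s)) / fbConst s ∂μ

/-- Tonelli reduces this to a single exponent, where the substitution l ↦ l|x| yields |x|^s `fbConst
s` and the constant, finite and nonzero, cancels. -/
lemma lintegral_mixtureSpectrum {μ : Measure ℝ} [IsFiniteMeasure μ] {β b : ℝ} (hβ : 1 < β)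
    (hb : b < 2) (hμ : ∀ᵐ s ∂μ, s ∈ Icc β b) (x : ℝ) :
    ∫⁻ l, ENNReal.ofReal (spectralKernel (l * x)) ∂mixtureSpectrum μ =
      ENNReal.ofReal (mixture μ x) := by
  rcases eq_or_ne x 0 with rfl | hx
  · simp [mixture_zero hβ hμ, spectralKernel_zero]
  have hk := measurable_spectralKernel
  have hc := measurable_fbConst
  have hdens : Measurable fun q : ℝ × ℝ => ENNReal.ofReal (q.1 ^ (-1 - q.2)) / fbConst q.2 := by
    fun_prop
  rw [mixtureSpectrum, lintegral_withDensity_eq_lintegral_mul _ hdens.lintegral_prod_right'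
    (by fun_prop)]
  simp only [Pi.mul_apply]
  have h1 : ∀ l : ℝ, (∫⁻ s, ENNReal.ofReal (l ^ (-1 - s)) / fbConst s ∂μ) *
      ENNReal.ofReal (spectralKernel (l * x)) =
      ∫⁻ s, ENNReal.ofReal (l ^ (-1 - s)) / fbConst s *
        ENNReal.ofReal (spectralKernel (l * x)) ∂μ :=
    fun l => (lintegral_mul_const _ (by fun_prop)).symm
  rw [lintegral_congr h1, lintegral_lintegral_swap (by
    refine Measurable.aemeasurable ?_
    unfold Function.uncurry
    fun_prop), mixture, ofReal_integral_eq_lintegral_ofReal (integrable_abs_rpow hβ hb hμ x)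
    (Eventually.of_forall fun s => Real.rpow_nonneg (abs_nonneg _) _)]
  refine lintegral_congr_ae ?_
  filter_upwards [hμ] with s hs
  have h2 : ∀ l : ℝ, ENNReal.ofReal (l ^ (-1 - s)) / fbConst s *
      ENNReal.ofReal (spectralKernel (l * x)) = (fbConst s)⁻¹ *
      (ENNReal.ofReal (l ^ (-1 - s)) * ENNReal.ofReal (spectralKernel (l * x))) := fun l => by
    rw [div_eq_mul_inv]
    ring
  rw [lintegral_congr h2, lintegral_const_mul _ (by fun_prop), lintegral_spectralKernel_mul hx,
    mul_comm, mul_assoc, ENNReal.mul_inv_cancel (fbConst_ne_zero s)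
      (fbConst_ne_top (by linarith [hs.1]) (by linarith [hs.2])), mul_one]

theorem exists_gaussian_mixture {μ : Measure ℝ} [IsFiniteMeasure μ] {β b : ℝ} (hβ : 1 < β)
    (hb : b < 2) (hμ : ∀ᵐ s ∂μ, s ∈ Icc β b) :
    ∃ (Ω : Type) (_ : MeasurableSpace Ω) (P : Measure Ω) (_ : IsProbabilityMeasure P)
      (G : ℝ≥0 → Ω → ℝ), IsStationaryIncrementGaussian P G (mixture μ) := by
  refine exists_gaussian_of_spectral (ν := mixtureSpectrum μ) (mixture_nonneg μ) fun x => ?_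
  simp_rw [enorm_exp_sub_one_sq]
  exact lintegral_mixtureSpectrum hβ hb hμ x

end FractionalSpectrum

/-! ### From Laplace transforms to mixtures, and conclusion. -/

section LaplaceMixture

lemma mixture_map_add {m : Measure ℝ} {β x : ℝ} (hx : x ≠ 0) :
    mixture (m.map fun t => β + t) x =
      |x| ^ β * ∫ t, Real.exp (-(Real.log (1 / |x|) * t)) ∂m := by
  have hx0 := abs_pos.2 hx
  rw [mixture, integral_map (by fun_prop) (Measurable.aestronglyMeasurable (by fun_prop)),
    ← integral_const_mul]
  refine integral_congr_ae (Eventually.of_forall fun t => ?_)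
  simp only
  rw [Real.rpow_add hx0, Real.rpow_def_of_pos hx0 t, one_div, Real.log_inv, neg_mul, neg_neg]

lemma tendsto_log_one_div_abs : Tendsto (fun x : ℝ => Real.log (1 / |x|)) (𝓝[≠] 0) atTop := by
  simp_rw [one_div]
  exact Real.tendsto_log_atTop.comp (tendsto_inv_nhdsGT_zero.comp tendsto_abs_nhdsNE_zero)

lemma mixture_isEquivalent {m : Measure ℝ} {k : ℝ → ℝ} {p A : ℝ} (hk : AntitoneRegVarying k p A)
    (hm : Tendsto (fun X => (∫ t, Real.exp (-(X * t)) ∂m) / k X) atTop (𝓝 1)) (β : ℝ) :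
    mixture (m.map fun t => β + t) ~[𝓝[≠] 0] fun x => |x| ^ β * k (Real.log (1 / |x|)) := by
  have h1 : (fun X => ∫ t, Real.exp (-(X * t)) ∂m) ~[atTop] k := by
    refine (isEquivalent_iff_tendsto_one ?_).2 hm
    filter_upwards [eventually_ge_atTop A] with x hx using (hk.pos x hx).ne'
  have h2 := (IsEquivalent.refl (u := fun x : ℝ => |x| ^ β) (l := 𝓝[≠] 0)).mul
    (h1.comp_tendsto tendsto_log_one_div_abs)
  refine h2.congr_left ?_
  filter_upwards [self_mem_nhdsWithin] with x hx using (mixture_map_add hx).symm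

end LaplaceMixture

end GaussInc

theorem proposition1p1 (h : ℝ → ℝ)
    (hh : (∃ p : ℝ, p < 0 ∧ GaussInc.RegVaryingAtTop h p) ∨
      (GaussInc.RegVaryingAtTop h 0 ∧ ∃ A : ℝ, AntitoneOn h (Set.Ici A)))
    (β : ℝ) (hβ₁ : 1 < β) (hβ₂ : β < 2) :
    ∃ (Ω : Type) (_ : MeasurableSpace Ω) (P : Measure Ω) (_ : IsProbabilityMeasure P)
      (G : ℝ≥0 → Ω → ℝ) (v : ℝ → ℝ),
      GaussInc.IsStationaryIncrementGaussian P G v ∧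
      GaussInc.IncrementConditions v ∧
      (v ~[𝓝[≠] 0] fun x => |x| ^ β * h (Real.log (1 / |x|))) ∧
      GaussInc.IsFBMixture β v := by
  obtain ⟨k, p, A, hk, hkh⟩ := GaussInc.exists_antitone_isEquivalent hh
  -- This δ places the shifted measure on [β, b] with b the midpoint of β and 2, so 1/(2 - s) stays
  -- bounded.
  obtain ⟨m, hmfin, hm0, hm⟩ := hk.exists_laplace (δ := (2 - β) / 2) (by linarith)
  set b := β + (2 - β) / 2 with hbdef
  have hb : b < 2 := by linarith
  set μ := m.map fun t => β + t
  have hμ : ∀ᵐ s ∂μ, s ∈ Icc β b := by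
    refine (ae_map_iff (by fun_prop) measurableSet_Icc).2 ?_
    filter_upwards [measure_eq_zero_iff_ae_notMem.1 hm0] with t ht
    rw [notMem_compl_iff] at ht
    exact ⟨by linarith [ht.1], by linarith [ht.2]⟩
  -- A zero measure would have zero Laplace transform, and the ratio to k could not tend to 1.
  have hμ0 : μ ≠ 0 := by
    rw [Ne, Measure.map_eq_zero_iff (by fun_prop)]
    rintro rfl
    simp at hm
  have hequiv := GaussInc.mixture_isEquivalent hk hm β
  obtain ⟨Ω, mΩ, P, hP, G, hG⟩ := GaussInc.exists_gaussian_mixture hβ₁ hb hμ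
  refine ⟨Ω, mΩ, P, hP, G, GaussInc.mixture μ, hG,
    GaussInc.incrementConditions_mixture hβ₁ hb hμ hμ0 hk hequiv, ?_,
    μ, inferInstance, ?_, ?_, fun x => rfl⟩
  · exact hequiv.trans
      (IsEquivalent.refl.mul (hkh.comp_tendsto GaussInc.tendsto_log_one_div_abs))
  · refine measure_eq_zero_iff_ae_notMem.2 ?_
    filter_upwards [hμ] with s hs
    rw [notMem_compl_iff]
    exact ⟨hs.1, by linarith [hs.2]⟩
  · have h1 : ∫⁻ s, (ENNReal.ofReal (2 - s))⁻¹ ∂μ ≤ ∫⁻ _, (ENNReal.ofReal (2 - b))⁻¹ ∂μ := by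
      refine lintegral_mono_ae ?_
      filter_upwards [hμ] with s hs
      exact ENNReal.inv_le_inv.2 (ENNReal.ofReal_le_ofReal (by linarith [hs.2]))
    refine h1.trans_lt ?_
    rw [lintegral_const]
    exact ENNReal.mul_lt_top (ENNReal.inv_lt_top.2 (ENNReal.ofReal_pos.2 (by linarith)))
      (measure_lt_top _ _)
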